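/- **Theorem (dataset generation algorithm).** Let $k$ be a field, $n\ge 1$, $d,d'>0$, $s_{\max}\ge n$, $m\ge 0$, and let $\prec$ be a term order on $k[x_1,\dots,x_n]$; $\prec_{\mathrm{lex}}$ is the lexicographic order with $x_1\succ\dots\succ x_n$. Consider the following algorithm. For $i=1,\dots,m$: sample a non-constant monic $h\in k[x_n]$ of degree $e\le d$ and $g_1,\dots,g_{n-1}\in k[x_n]$ of degree at most $e-1$, and put $G=(h,x_1-g_1,\dots,x_{n-1}-g_{n-1})^{\top}$; sample $s_i\in\{n,\dots,s_{\max}\}$, upper-triangular matrices $U_1$ (of size $s_i$) and $U_2'$ (of size $n$) with ones on the diagonal and polynomial entries of total degree at most $d'$, and a permutation matrix $P$ of size $s_i$; let $U_2$ be $U_2'$ with $s_i-n$ zero rows appended, let $F_i$ be the set of entries of $U_1PU_2G$, and let $G_i$ be the set of entries of $G$ if $\prec=\prec_{\mathrm{lex}}$, and the output of the FGLM algorithm, converting $G$ from $\prec_{\mathrm{lex}}$ to $\prec$, otherwise. The output is $\{(F_i,G_i)\}_{i=1}^m$. For every outcome of the sampling and every $i$: 1. $|F_i|\le s_{\max}$;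 $|G_i|=n$ if $\prec=\prec_{\mathrm{lex}}$, and $|G_i|\ge n$ for every $\prec$. 2. $G_i$ is the reduced $\prec$-Gröbner basis of $\langle F_i\rangle$. The set $F_i$ is not, unless $n=s_i=1$ or the sampled coefficients lie in a proper Zariski-closed set: for each choice of $e$, $s$ and $P$ there is a nonzero polynomial $Q$ over $k$ in the sampled coefficients of $h,g_1,\dots,g_{n-1},U_1,U_2'$, of total degree at most $Cs$, that vanishes whenever $s\ge 2$ and $F_i$ is the reduced $\prec$-Gröbner basis of $\langle F_i\rangle$, and, if $n\ge 2$, even whenever $F_i$ is any $\prec$-Gröbner basis of $\langle F_i\rangle$. If the coefficients are sampled uniformly and independently from a finite non-empty set $B\subset k$, then $Q$ vanishes with probability at most $Cs/|B|$. 3. $\langle F_i\rangle=\langle G_i\rangle$ is a zero-dimensional ideal in shape position: the quotient ring is finite-dimensional over $k$, and the reduced $\prec_{\mathrm{lex}}$-Gröbner basis has the form $\{h,x_1-g_1,\dots,x_{n-1}-g_{n-1}\}$ with $h,g_j\in k[x_n]$. Time is measured as follows: an arithmetic operation or zero test in $k$ costs $1$, sampling an $r$-variate polynomial of total degree at most $D$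 costs $S_{r,D}$, multiplying two $r$-variate polynomials of total degree at most $D$ costs $M_{r,D}$, adding two of them costs $\binom{r+D}{r}$ (one step per coefficient), and sampling $s$ and $P$ costs $1$ and $s$. Here $S_{r,D}$ and $M_{r,D}$ are any non-decreasing functions of $D$ that are at least the number $\binom{r+D}{r}$ of coefficients. Then for every outcome of the sampling the running time is at most $$C\sum_{i=1}^m\bigl(n\,S_{1,d}+s_i^2\,S_{n,d'}+(n^2+s_i^2)\,M_{n,2d'+d}\bigr)$$ if $\prec=\prec_{\mathrm{lex}}$, and at most this bound plus $C\,m\,n\,d^3$ if $\prec\ne\prec_{\mathrm{lex}}$. The constant $C$ is absolute; in particular it does not depend on $k,n,d,d',s_{\max},m,\prec,S,M$. -/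

import Mathlib

universe u v

open MvPolynomial

noncomputable section

/-! ## Gröbner bases, zero-dimensional ideals, shape position

Throughout, the polynomial ring in `n = N + 1` variables is `MvPolynomial (Fin (N + 1)) k`; the last
variable `x_n` is `X (Fin.last N)` and the other ones are `X j.castSucc`, `j : Fin N`. In
`MonomialOrder.lex` one has `X 0 > X 1 > ⋯ > X (Fin.last N)`. -/

section Groebner

variable {k : Type*} [Field k] {n N : ℕ}

/-- `G` is a Gröbner basis of the ideal `I` for the term order `ord`. -/
def IsGroebnerBasis (ord : MonomialOrder (Fin n)) (G : Finset (MvPolynomial (Fin n) k))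
    (I : Ideal (MvPolynomial (Fin n) k)) : Prop :=
  (G : Set (MvPolynomial (Fin n) k)) ⊆ I ∧
    Ideal.span (ord.leadingTerm '' (G : Set (MvPolynomial (Fin n) k))) =
      Ideal.span (ord.leadingTerm '' (I : Set (MvPolynomial (Fin n) k)))

/-- `G` is the reduced Gröbner basis of the ideal `I` for the term order `ord`. -/
def IsReducedGroebnerBasis (ord : MonomialOrder (Fin n)) (G : Finset (MvPolynomial (Fin n) k))
    (I : Ideal (MvPolynomial (Fin n) k)) : Prop :=
  IsGroebnerBasis ord G I ∧
    ∀ g ∈ G, ord.leadingCoeff g = 1 ∧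
      ∀ a ∈ g.support, monomial a (1 : k) ∉
        Ideal.span (ord.leadingTerm '' ((G : Set (MvPolynomial (Fin n) k)) \ {g}))

/-- The quotient by `I` is a finite-dimensional vector space. -/
def IsZeroDimensional (I : Ideal (MvPolynomial (Fin n) k)) : Prop :=
  Module.Finite k (MvPolynomial (Fin n) k ⧸ I)

/-- The univariate polynomial `f` as a polynomial in the last variable. -/
def inLastVar (f : Polynomial k) : MvPolynomial (Fin (N + 1)) k :=
  Polynomial.aeval (X (Fin.last N)) f

/-- The reduced lexicographic Gröbner basis of `I` is `{h, x₁ - g₁, …, x_{n-1} - g_{n-1}}` for some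
univariate polynomials `h, g₁, …, g_{n-1}` in the last variable. -/
def IsInShapePosition (I : Ideal (MvPolynomial (Fin (N + 1)) k)) : Prop :=
  ∃ (h : Polynomial k) (g : Fin N → Polynomial k) (G : Finset (MvPolynomial (Fin (N + 1)) k)),
    (G : Set (MvPolynomial (Fin (N + 1)) k)) =
      insert (inLastVar h) (Set.range fun j => X j.castSucc - inLastVar (g j)) ∧
    IsReducedGroebnerBasis MonomialOrder.lex G I

/-- `ord` is the lexicographic order, that is, it compares any two terms in the same way. -/
def IsLex (ord : MonomialOrder (Fin n)) : Prop :=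
  ∀ a b : Fin n →₀ ℕ,
    ord.toSyn a ≤ ord.toSyn b ↔
      (MonomialOrder.lex (σ := Fin n)).toSyn a ≤ (MonomialOrder.lex (σ := Fin n)).toSyn b

end Groebner

/-! ## Computations with a step count -/

/-- The result of a computation together with the number of steps it took. -/
structure Timed (α : Type*) where
  val : α
  cost : ℕ

namespace Timed

instance : Monad Timed where
  pure a := ⟨a, 0⟩
  bind x f := ⟨(f x.val).val, x.cost + (f x.val).cost⟩

/-- A primitive operation with result `a` that takes `c` steps. -/
def charge {α : Type*} (c : ℕ) (a : α) : Timed α := ⟨a, c⟩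

/-- Carry out finitely many computations one after the other. -/
def all {ι α : Type*} [Fintype ι] (x : ι → Timed α) : Timed (ι → α) :=
  ⟨fun i => (x i).val, ∑ i, (x i).cost⟩

end Timed

open Timed

/-! ### Arithmetic operations of the field (one step each) and vectors over it -/

section FieldOps

variable {k : Type*} [Field k]

def fieldAdd (a b : k) : Timed k := charge 1 (a + b)
def fieldSub (a b : k) : Timed k := charge 1 (a - b)
def fieldMul (a b : k) : Timed k := charge 1 (a * b)
def fieldInv (a : k) : Timed k := charge 1 a⁻¹

/-- `v + c • w` -/
def vecAddMul {e : ℕ} (v : Fin e → k) (c : k) (w : Fin e → k) : Timed (Fin e → k) :=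
  Timed.all fun i => do
    let t ← fieldMul c (w i)
    fieldAdd (v i) t

/-- `v - c • w` -/
def vecSubMul {e : ℕ} (v : Fin e → k) (c : k) (w : Fin e → k) : Timed (Fin e → k) :=
  Timed.all fun i => do
    let t ← fieldMul c (w i)
    fieldSub (v i) t

/-- `c • v` -/
def vecScale {e : ℕ} (c : k) (v : Fin e → k) : Timed (Fin e → k) :=
  Timed.all fun i => fieldMul c (v i)

/-- `c₁ • v₁ + c₂ • v₂ + ⋯` -/
def linComb {e : ℕ} : List k → List (Fin e → k) → Timed (Fin e → k)
  | c :: cs, v :: vs => do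
    let r ← linComb cs vs
    vecAddMul r c v
  | _, _ => pure 0

/-- `q - c • r`, with one multiplication and one subtraction for each term of `r`. -/
def polySubMul {n : ℕ} (q : MvPolynomial (Fin n) k) (c : k) (r : MvPolynomial (Fin n) k) :
    Timed (MvPolynomial (Fin n) k) :=
  charge (2 * r.support.card) (q - c • r)

/-- `c • q`, with one multiplication for each term of `q`. -/
def polyScale {n : ℕ} (c : k) (q : MvPolynomial (Fin n) k) : Timed (MvPolynomial (Fin n) k) :=
  charge q.support.card (c • q)

end FieldOps

/-! ### Multiplication and addition of polynomials

`M n D` is the cost of multiplying two `n`-variate polynomials of total degree at most `D`. An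
addition takes one step for each of the `(n + D).choose n` coefficients. -/

section PolyOps

variable {k : Type*} [Field k] {n : ℕ}

def polyMul (M : ℕ → ℕ → ℕ) (f g : MvPolynomial (Fin n) k) : Timed (MvPolynomial (Fin n) k) :=
  charge (M n (max f.totalDegree g.totalDegree)) (f * g)

def polyAdd (f g : MvPolynomial (Fin n) k) : Timed (MvPolynomial (Fin n) k) :=
  charge ((n + max f.totalDegree g.totalDegree).choose n) (f + g)

/-- `a₁ b₁ + a₂ b₂ + ⋯` -/
def polyDot (M : ℕ → ℕ → ℕ) :
    List (MvPolynomial (Fin n) k × MvPolynomial (Fin n) k) → Timed (MvPolynomial (Fin n) k)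
  | [] => pure 0
  | (a, b) :: l => do
    let p ← polyMul M a b
    let q ← polyDot M l
    polyAdd p q

/-- The product of a polynomial matrix and a polynomial vector. -/
def polyMulVec (M : ℕ → ℕ → ℕ) {a b : ℕ} (A : Matrix (Fin a) (Fin b) (MvPolynomial (Fin n) k))
    (v : Fin b → MvPolynomial (Fin n) k) : Timed (Fin a → MvPolynomial (Fin n) k) :=
  Timed.all fun i => polyDot M (List.ofFn fun j => (A i j, v j))

end PolyOps

/-! ## The FGLM change of ordering

The input is the lexicographic basis `h = x_n ^ e + ∑ a, hc a * x_n ^ a`,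
`x_j - ∑ a, gc j a * x_n ^ a`. Normal forms with respect to it are polynomials in `x_n` of degree
less than `e`, stored as their vectors of coefficients. -/

section FGLM

variable {k : Type*} [Field k] {N e : ℕ}

/-- The normal form of `x_n * v`. -/
def mulLast (hc : Fin e → k) (v : Fin e → k) : Timed (Fin e → k) :=
  let top : Fin e → k := fun i => v ⟨e - 1, by have := i.2; omega⟩
  Timed.all fun i => do
    let t ← fieldMul (top i) (hc i)
    fieldSub (if (i : ℕ) = 0 then 0 else v ⟨i - 1, by have := i.2; omega⟩) t

/-- The normal forms of `v, x_n * v, …, x_n ^ (r - 1) * v`. -/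
def powersTimes (hc : Fin e → k) : ℕ → (Fin e → k) → Timed (List (Fin e → k))
  | 0, _ => pure []
  | r + 1, v => do
    let w ← mulLast hc v
    let l ← powersTimes hc r w
    pure (v :: l)

/-- The normal form of `1`. -/
def oneVec : Fin e → k := fun i => if (i : ℕ) = 0 then 1 else 0

/-- The normal form of a variable. -/
def varVec (hc : Fin e → k) (gc : Fin N → Fin e → k) : Fin (N + 1) → Timed (Fin e → k) :=
  Fin.lastCases (mulLast hc oneVec) fun j => pure (gc j)

/-- The multiplication matrices: for each variable `x_j`, the list of the normal forms of
`x_j, x_j * x_n, …, x_j * x_n ^ (e - 1)`. -/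
def multTables (hc : Fin e → k) (gc : Fin N → Fin e → k) :
    Timed (Fin (N + 1) → List (Fin e → k)) :=
  Timed.all fun j => do
    let v ← varVec hc gc j
    powersTimes hc e v

/-- The state of the main loop.
* `cand`: the terms still to be examined, with their normal forms;
* `ech`: the row echelon form of the normal forms of the standard terms found so far, each row
  consisting of the position of its pivot (with entry `1`), the vector, and a combination of
  standard terms with this normal form;
* `gb`: the elements of the new Gröbner basis found so far. -/
structure FGLMState (k : Type*) [Field k] (N e : ℕ) where
  cand : List ((Fin (N + 1) →₀ ℕ) × (Fin e → k))
  ech : List (Fin e × (Fin e → k) × MvPolynomial (Fin (N + 1)) k)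
  gb : List (MvPolynomial (Fin (N + 1)) k)

/-- Reduce the polynomial `q` with normal form `v` by the rows of an echelon form. -/
def echReduce : List (Fin e × (Fin e → k) × MvPolynomial (Fin (N + 1)) k) →
    (Fin e → k) → MvPolynomial (Fin (N + 1)) k →
    Timed ((Fin e → k) × MvPolynomial (Fin (N + 1)) k)
  | [], v, q => pure (v, q)
  | (p, w, r) :: E, v, q => do
    let v' ← vecSubMul v (v p) w
    let q' ← polySubMul q (v p) r
    echReduce E v' q'

open Classical in
/-- The position and the value of the first nonzero entry of `v`, by `e` tests for zero. -/
def findPivot (v : Fin e → k) : Timed (Option (Fin e × k)) :=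
  charge e (((List.finRange e).find? fun p => v p ≠ 0).map fun p => (p, v p))

open Classical in
/-- The main loop: take the smallest candidate `t`. If it is a multiple of a leading term of the new
basis, drop it. Otherwise reduce its normal form by those of the smaller standard terms. If the
result is zero, the relation found is a new basis element; if not, `t` is a standard term, and its
multiples by the variables become candidates. -/
def fglmLoop (ord : MonomialOrder (Fin (N + 1))) (tables : Fin (N + 1) → List (Fin e → k)) :
    ℕ → FGLMState k N e → Timed (List (MvPolynomial (Fin (N + 1)) k))
  | 0, st => pure st.gb
  | fuel + 1, st =>
    match st.cand.argmin (fun c => ord.toSyn c.1) with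
    | none => pure st.gb
    | some (t, v) =>
      let rest := st.cand.filter fun c => c.1 ≠ t
      if ∃ g ∈ st.gb, ord.degree g ≤ t then
        fglmLoop ord tables fuel { st with cand := rest }
      else do
        let (v', q) ← echReduce st.ech v (monomial t 1)
        let pivot ← findPivot v'
        match pivot with
        | none => fglmLoop ord tables fuel { st with cand := rest, gb := st.gb ++ [q] }
        | some (p, a) =>
          let c ← fieldInv a
          let w ← vecScale c v'
          let r ← polyScale c q
          let new ← Timed.all fun j => linComb (List.ofFn v) (tables j)
          fglmLoop ord tables fuel
            { cand := rest ++ List.ofFn fun j => (t + Finsupp.single j 1, new j)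
              ech := st.ech ++ [(p, w, r)]
              gb := st.gb }

/-- The FGLM algorithm. There are at most `1 + n * e` different candidates, namely `1` and the
multiples of the `e` standard terms by the `n` variables. -/
def fglm (ord : MonomialOrder (Fin (N + 1))) (hc : Fin e → k) (gc : Fin N → Fin e → k) :
    Timed (List (MvPolynomial (Fin (N + 1)) k)) := do
  let tables ← multTables hc gc
  fglmLoop ord tables (1 + (N + 1) * e) { cand := [(0, oneVec)], ech := [], gb := [] }

end FGLM

/-! ## The random choices -/

/-- The exponent vectors of total degree at most `D` in `n` variables. -/
abbrev Expo (n D : ℕ) : Type := {a : Fin n → Fin (D + 1) // ∑ i, (a i : ℕ) ≤ D}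

/-- The polynomial of total degree at most `D` with given coefficients. -/
def polyOfCoeffs {k : Type*} [Field k] {n D : ℕ} (c : Expo n D → k) : MvPolynomial (Fin n) k :=
  ∑ a, monomial (Finsupp.equivFunOnFinite.symm fun i => (a.1 i : ℕ)) (c a)

/-- The positions strictly above the diagonal. -/
abbrev Above (s : ℕ) : Type := {p : Fin s × Fin s // p.1 < p.2}

/-- The upper-triangular matrix with ones on the diagonal and given entries above it. -/
def unitUpper {R : Type*} [CommRing R] {s : ℕ} (c : Above s → R) : Matrix (Fin s) (Fin s) R :=
  fun i j => if h : i < j then c ⟨(i, j), h⟩ else if i = j then 1 else 0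

/-- The discrete random choices made for one pair: the degree of `h`, the size `s` of `F`, and the
permutation. -/
structure Shape (N d smax : ℕ) where
  deg : ℕ
  deg_pos : 0 < deg
  deg_le : deg ≤ d
  size : ℕ
  le_size : N + 1 ≤ size
  size_le : size ≤ smax
  perm : Equiv.Perm (Fin size)

/-- The names of the coefficients sampled for one pair: the non-leading coefficients of the monic
polynomial `h` of degree `e`; the coefficients of `g₁, …, g_{n-1}`, of degree at most `e - 1`; those
of the entries above the diagonal of `U₁` (of size `s`) and of `U₂'` (of size `n`), of total degree
at most `d'`. -/
abbrev Coord (N d' e s : ℕ) : Type :=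
  (Fin e ⊕ (Fin N × Fin e)) ⊕
    ((Above s × Expo (N + 1) d') ⊕ (Above (N + 1) × Expo (N + 1) d'))

/-- All the random choices made for one pair. -/
structure Draw (k : Type*) (N d d' smax : ℕ) where
  shape : Shape N d smax
  coeff : Coord N d' shape.deg shape.size → k

namespace Draw

variable {k : Type*} [Field k] {N d d' smax : ℕ} (ω : Draw k N d d' smax)

def hCoeff : Fin ω.shape.deg → k := fun a => ω.coeff (.inl (.inl a))

def gCoeff : Fin N → Fin ω.shape.deg → k := fun j a => ω.coeff (.inl (.inr (j, a)))

def h : MvPolynomial (Fin (N + 1)) k :=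
  X (Fin.last N) ^ ω.shape.deg + ∑ a, C (ω.hCoeff a) * X (Fin.last N) ^ (a : ℕ)

def g (j : Fin N) : MvPolynomial (Fin (N + 1)) k :=
  ∑ a, C (ω.gCoeff j a) * X (Fin.last N) ^ (a : ℕ)

def U₁ : Matrix (Fin ω.shape.size) (Fin ω.shape.size) (MvPolynomial (Fin (N + 1)) k) :=
  unitUpper fun p => polyOfCoeffs fun a => ω.coeff (.inr (.inl (p, a)))

def U₂' : Matrix (Fin (N + 1)) (Fin (N + 1)) (MvPolynomial (Fin (N + 1)) k) :=
  unitUpper fun p => polyOfCoeffs fun a => ω.coeff (.inr (.inr (p, a)))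

end Draw

/-- The proportion of zeros of `Q` among the points with coordinates in the finite set `B`. -/
def zeroProportion {k ι : Type*} [Field k] [Fintype ι] (Q : MvPolynomial ι k) (B : Finset k) : ℚ :=
  (Nat.card {c : ι → B // eval (fun i => (c i : k)) Q = 0} : ℚ) / Nat.card (ι → B)

/-! ## The dataset generation algorithm -/

section Algorithm

variable {k : Type*} [Field k] {N d d' smax : ℕ}

/-- The first part of the loop body: sample `h, g₁, …, g_{n-1}` and form the vector
`(h, x₁ - g₁, …, x_{n-1} - g_{n-1})`. Sampling an `n`-variate polynomial of total degree at most `D`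
costs `S n D`; a change of sign takes one step for each coefficient. -/
def sampleBasis (S : ℕ → ℕ → ℕ) (ω : Draw k N d d' smax) :
    Timed (Fin (N + 1) → MvPolynomial (Fin (N + 1)) k) := do
  let h ← charge (S 1 d) ω.h
  let g ← Timed.all fun j => charge (S 1 (ω.shape.deg - 1)) (ω.g j)
  let l ← Timed.all fun j => charge ω.shape.deg (X j.castSucc - g j)
  pure (Fin.cons h l)

/-- The second part of the loop body: sample `s` (one step), `U₁`, `U₂'` and `P` (`s` steps), and
compute `F = U₁ P U₂ G`, where `U₂` is `U₂'` with `s - n` zero rows appended. -/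
def backwardTransform (S M : ℕ → ℕ → ℕ) (ω : Draw k N d d' smax)
    (G : Fin (N + 1) → MvPolynomial (Fin (N + 1)) k) :
    Timed (Fin ω.shape.size → MvPolynomial (Fin (N + 1)) k) := do
  let U₁ ← charge (1 + ∑ _p : Above ω.shape.size, S (N + 1) d') ω.U₁
  let U₂' ← charge (∑ _p : Above (N + 1), S (N + 1) d') ω.U₂'
  let w ← polyMulVec M U₂' G
  let w' : Fin ω.shape.size → MvPolynomial (Fin (N + 1)) k :=
    fun i => if h : (i : ℕ) < N + 1 then w ⟨i, h⟩ else 0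
  let y ← charge ω.shape.size fun i => w' (ω.shape.perm i)
  polyMulVec M U₁ y

open Classical in
/-- The loop body. -/
def generatePair (S M : ℕ → ℕ → ℕ) (ord : MonomialOrder (Fin (N + 1))) (ω : Draw k N d d' smax) :
    Timed (Finset (MvPolynomial (Fin (N + 1)) k) × Finset (MvPolynomial (Fin (N + 1)) k)) := do
  let G ← sampleBasis S ω
  let F ← backwardTransform S M ω G
  if IsLex ord then
    pure (Finset.univ.image F, Finset.univ.image G)
  else do
    let G' ← fglm ord ω.hCoeff ω.gCoeff
    pure (Finset.univ.image F, G'.toFinset)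

/-- The algorithm: the `i`-th pass of the loop uses the random choices `ω i`. -/
def generateDataset (S M : ℕ → ℕ → ℕ) (ord : MonomialOrder (Fin (N + 1))) {m : ℕ}
    (ω : Fin m → Draw k N d d' smax) :
    Timed (Fin m →
      Finset (MvPolynomial (Fin (N + 1)) k) × Finset (MvPolynomial (Fin (N + 1)) k)) :=
  Timed.all fun i => generatePair S M ord (ω i)

end Algorithm

end

/-! The ideal never changes: `U₁` and `U₂'` have determinant one, `P` permutes, and padding only
adds zeros, so `F` and the triangular vector `G` generate the same ideal `triIdeal`. Modulo this
ideal every polynomial is congruent to exactly one polynomial in x_n of degree less than e = deg h.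
Existence follows by replacing x_j by g_j and reducing by h; uniqueness holds because the
substitution x_j ↦ g_j sends the ideal into (h) in k[x_n] (`exists_isNF`, `eq_zero_of_lastEmb_mem`).
This gives finite dimension, shape position and the lexicographic case.

For other orders, FGLM examines terms in increasing order. The normal form of a term is either
independent of those of the smaller standard terms, or yields a relation that becomes a basis
element. `FGLMInvariant` records this. At the end every term is standard or a multiple of a leading
term, and only 0 in the ideal is supported on standard terms; by
`isReducedGroebnerBasis_of_remainder_eq_zero` this suffices. An echelon form in k^e has at most e
rows, so there are at most 1 + ne candidates. Each costs O(e²), and each of the at most e standard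
terms a further O(ne²), which gives O(ne³) (`fglmLoop_spec`).

Genericity for n ≥ 2: let B = x_{n-1} - g_{n-1}, let δ be its generic leading exponent and x_m the
largest variable. The last entry of `U₂' G` is always B. Let l be the last position of `P U₂ G` not
filled by padding. Below l the output is zero; at or above l, each output entry generically has a
nonzero coefficient at x_m δ, except when it is B itself, in position l. Hence all leading terms are
at least x_m δ, apart possibly from one equal to δ. If B does not sit in position l, then B lies in
the ideal but its leading term, at most δ, is divisible by none of them. Otherwise,
`exists_small_terms` gives e + 1 terms that are below x_m δ and not multiples of δ; they are
dependent modulo the ideal, and the resulting element has a leading term divisible by none of the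
others. The relevant coefficients have degree at most 3 in the sample, one for each of the factors
`U₁`, `U₂'` and `G`, so their product over the s positions is a polynomial Q of degree at most 3s.
The probability bound is Schwartz–Zippel.

For n = 1 the output consists of multiples of h. If it is the reduced basis and s ≥ 2, then the
upper right corner of `U₁` equals 1, so its coefficient at x_1 vanishes; this coefficient is Q. -/

noncomputable section

open Timed

/-! ### A criterion for Gröbner bases by division with remainder -/

section GroebnerCriterion

variable {k : Type*} [Field k] {n : ℕ} {ord : MonomialOrder (Fin n)}

/-- Over a field leading coefficients are units, so this is a monomial ideal, where membership is
divisibility by a generator. -/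
lemma monomial_mem_span_leadingTerm_iff {B : Set (MvPolynomial (Fin n) k)} {a : Fin n →₀ ℕ} :
    monomial a (1 : k) ∈ Ideal.span (ord.leadingTerm '' B) ↔
      ∃ p ∈ B, p ≠ 0 ∧ ord.degree p ≤ a := by
  classical
  rw [ord.span_leadingTerm_eq_span_monomial', ← Set.image_image (fun s => monomial s (1 : k)),
    mem_ideal_span_monomial_image]
  simp [support_monomial, and_assoc]

lemma IsGroebnerBasis.exists_degree_le {G : Finset (MvPolynomial (Fin n) k)}
    {I : Ideal (MvPolynomial (Fin n) k)} (hG : IsGroebnerBasis ord G I)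
    {f : MvPolynomial (Fin n) k} (hf : f ∈ I) (hf0 : f ≠ 0) :
    ∃ g ∈ G, g ≠ 0 ∧ ord.degree g ≤ ord.degree f := by
  have h : monomial (ord.degree f) (1 : k) ∈ Ideal.span (ord.leadingTerm '' (I : Set _)) :=
    monomial_mem_span_leadingTerm_iff.2 ⟨f, hf, hf0, le_rfl⟩
  rw [← hG.2] at h
  exact monomial_mem_span_leadingTerm_iff.1 h

/-- The remainder of `f` on division by `G` lies in `I` and has no term divisible by a leading term
of `G`, so `hI` makes it zero. -/
lemma exists_isRemainder_mem {G : Finset (MvPolynomial (Fin n) k)}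
    {I : Ideal (MvPolynomial (Fin n) k)} (hGI : ∀ g ∈ G, g ∈ I)
    (hlc : ∀ g ∈ G, ord.leadingCoeff g = 1)
    (hI : ∀ r ∈ I, (∀ a ∈ r.support, ∀ g ∈ G, ¬ ord.degree g ≤ a) → r = 0)
    {f : MvPolynomial (Fin n) k} (hf : f ∈ I) :
    ∃ c : (G : Set (MvPolynomial (Fin n) k)) →₀ MvPolynomial (Fin n) k,
      f = Finsupp.linearCombination _
        (fun b : (G : Set (MvPolynomial (Fin n) k)) => (b : MvPolynomial (Fin n) k)) c ∧
      ∀ b : (G : Set (MvPolynomial (Fin n) k)),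
        ord.toSyn (ord.degree ((b : MvPolynomial (Fin n) k) * c b)) ≤ ord.toSyn (ord.degree f) := by
  obtain ⟨c, r, h1, h2, h3⟩ := ord.div_set (B := (G : Set (MvPolynomial (Fin n) k)))
    (fun b hb => by rw [hlc b hb]; exact isUnit_one) f
  have hr : r = 0 := by
    refine hI r ?_ h3
    have : r = f - Finsupp.linearCombination _
        (fun b : (G : Set (MvPolynomial (Fin n) k)) => (b : MvPolynomial (Fin n) k)) c := by
      rw [h1]; ring
    rw [this]
    refine I.sub_mem hf ?_
    rw [Finsupp.linearCombination_apply]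
    exact I.sum_mem fun b _ => I.mul_mem_left _ (hGI b b.2)
  exact ⟨c, by simpa [hr] using h1, h2⟩

lemma span_eq_of_remainder_eq_zero {G : Finset (MvPolynomial (Fin n) k)}
    {I : Ideal (MvPolynomial (Fin n) k)} (hGI : ∀ g ∈ G, g ∈ I)
    (hlc : ∀ g ∈ G, ord.leadingCoeff g = 1)
    (hI : ∀ r ∈ I, (∀ a ∈ r.support, ∀ g ∈ G, ¬ ord.degree g ≤ a) → r = 0) :
    Ideal.span (G : Set (MvPolynomial (Fin n) k)) = I := by
  refine le_antisymm (Ideal.span_le.2 hGI) fun f hf => ?_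
  obtain ⟨c, h1, -⟩ := exists_isRemainder_mem hGI hlc hI hf
  rw [h1, Finsupp.linearCombination_apply]
  exact Ideal.sum_mem _ fun b _ => Ideal.mul_mem_left _ _ (Ideal.subset_span b.2)

/-- In a representation of `f` whose summands have degree at most that of `f`, some summand must
attain this degree, as otherwise the leading coefficient of `f` would be zero. The leading term of
the corresponding `b` then divides that of `f`. -/
lemma isGroebnerBasis_of_remainder_eq_zero {G : Finset (MvPolynomial (Fin n) k)}
    {I : Ideal (MvPolynomial (Fin n) k)} (hGI : ∀ g ∈ G, g ∈ I)
    (hlc : ∀ g ∈ G, ord.leadingCoeff g = 1)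
    (hI : ∀ r ∈ I, (∀ a ∈ r.support, ∀ g ∈ G, ¬ ord.degree g ≤ a) → r = 0) :
    IsGroebnerBasis ord G I := by
  refine ⟨hGI, le_antisymm (Ideal.span_mono (Set.image_mono hGI)) (Ideal.span_le.2 ?_)⟩
  rintro _ ⟨f, hf, rfl⟩
  by_cases hf0 : f = 0
  · simp [hf0]
  obtain ⟨c, h1, h2⟩ := exists_isRemainder_mem hGI hlc hI hf
  have hex : ∃ b : (G : Set (MvPolynomial (Fin n) k)),
      coeff (ord.degree f) ((b : MvPolynomial (Fin n) k) * c b) ≠ 0 := by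
    by_contra! hcon
    have key : ∀ m, (∀ b : (G : Set (MvPolynomial (Fin n) k)),
        coeff m ((b : MvPolynomial (Fin n) k) * c b) = 0) → coeff m f = 0 := by
      intro m hm
      rw [h1, Finsupp.linearCombination_apply, Finsupp.sum, coeff_sum]
      refine Finset.sum_eq_zero fun b _ => ?_
      rw [smul_eq_mul, mul_comm]
      exact hm b
    exact (ord.coeff_degree_ne_zero_iff.2 hf0) (key _ hcon)
  obtain ⟨b, hb⟩ := hex
  have hne : (b : MvPolynomial (Fin n) k) * c b ≠ 0 := by
    intro h; simp [h] at hb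
  have hdeg : ord.degree ((b : MvPolynomial (Fin n) k) * c b) = ord.degree f :=
    ord.toSyn.injective (le_antisymm (h2 b) (ord.le_degree (mem_support_iff.2 hb)))
  rw [ord.degree_mul' hne] at hdeg
  have hm : monomial (ord.degree f) (1 : k) ∈
      Ideal.span (ord.leadingTerm '' (G : Set (MvPolynomial (Fin n) k))) :=
    monomial_mem_span_leadingTerm_iff.2
      ⟨b, b.2, left_ne_zero_of_mul hne, by rw [← hdeg]; exact le_self_add⟩
  have := Ideal.mul_mem_left _ (C (ord.leadingCoeff f)) hm
  rwa [MonomialOrder.C_mul_leadingCoeff_monomial_degree] at this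

/-- The common criterion for the triangular basis and for the FGLM output. Both meet `hI` through
uniqueness of normal forms, without S-polynomials. -/
lemma isReducedGroebnerBasis_of_remainder_eq_zero {G : Finset (MvPolynomial (Fin n) k)}
    {I : Ideal (MvPolynomial (Fin n) k)} (hGI : ∀ g ∈ G, g ∈ I)
    (hlc : ∀ g ∈ G, ord.leadingCoeff g = 1)
    (hred : ∀ g ∈ G, ∀ a ∈ g.support, ∀ g' ∈ G, g' ≠ g → ¬ ord.degree g' ≤ a)
    (hI : ∀ r ∈ I, (∀ a ∈ r.support, ∀ g ∈ G, ¬ ord.degree g ≤ a) → r = 0) :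
    IsReducedGroebnerBasis ord G I := by
  refine ⟨isGroebnerBasis_of_remainder_eq_zero hGI hlc hI, fun g hg => ⟨hlc g hg, ?_⟩⟩
  intro a ha hmem
  obtain ⟨p, ⟨hpG, hpg⟩, -, hle⟩ := monomial_mem_span_leadingTerm_iff.1 hmem
  exact hred g hg a ha p hpG hpg hle

/-- A monomial of the support that dominates the support is the degree. -/
lemma degree_eq_of_le {f : MvPolynomial (Fin n) k} {a : Fin n →₀ ℕ} (ha : a ∈ f.support)
    (h : ∀ b ∈ f.support, ord.toSyn b ≤ ord.toSyn a) : ord.degree f = a :=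
  ord.toSyn.injective (le_antisymm (ord.degree_le_iff.2 h) (ord.le_degree ha))

end GroebnerCriterion

/-! ### Normal forms modulo the triangular ideal -/

section TriangularIdeal

variable {k : Type*} [Field k] {N e : ℕ}

/-- The polynomial in the last variable with given coefficients. -/
def lastEmb : (Fin e → k) →ₗ[k] MvPolynomial (Fin (N + 1)) k where
  toFun v := ∑ a, C (v a) * X (Fin.last N) ^ (a : ℕ)
  map_add' v w := by simp [add_mul, Finset.sum_add_distrib]
  map_smul' c v := by simp [Finset.smul_sum, smul_eq_C_mul, mul_assoc]

lemma lastEmb_apply (v : Fin e → k) :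
    (lastEmb v : MvPolynomial (Fin (N + 1)) k) = ∑ a, C (v a) * X (Fin.last N) ^ (a : ℕ) := rfl

lemma lastEmb_eq_sum_monomial (v : Fin e → k) :
    (lastEmb v : MvPolynomial (Fin (N + 1)) k) =
      ∑ a : Fin e, monomial (Finsupp.single (Fin.last N) (a : ℕ)) (v a) := by
  simp [lastEmb_apply, X_pow_eq_monomial, C_mul_monomial]

lemma exists_of_mem_support_lastEmb {v : Fin e → k} {a : Fin (N + 1) →₀ ℕ}
    (ha : a ∈ (lastEmb v : MvPolynomial (Fin (N + 1)) k).support) :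
    ∃ i : Fin e, a = Finsupp.single (Fin.last N) (i : ℕ) := by
  classical
  rw [lastEmb_eq_sum_monomial, mem_support_iff, coeff_sum] at ha
  obtain ⟨i, -, hi⟩ := Finset.exists_ne_zero_of_sum_ne_zero ha
  rw [coeff_monomial] at hi
  exact ⟨i, (by by_contra h; exact hi (if_neg (Ne.symm h)))⟩

lemma coeff_lastEmb_single (v : Fin e → k) (i : Fin e) :
    coeff (Finsupp.single (Fin.last N) (i : ℕ))
      (lastEmb v : MvPolynomial (Fin (N + 1)) k) = v i := by
  classical
  rw [lastEmb_eq_sum_monomial, coeff_sum, Finset.sum_eq_single i]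
  · simp
  · intro j _ hj
    rw [coeff_monomial, if_neg]
    intro h
    exact hj (Fin.ext (Finsupp.single_injective _ h))
  · simp

/-- The vector `(h, x₁ - g₁, …, x_{n-1} - g_{n-1})`. -/
def triBasis (hc : Fin e → k) (gc : Fin N → Fin e → k) :
    Fin (N + 1) → MvPolynomial (Fin (N + 1)) k :=
  Fin.cons (X (Fin.last N) ^ e + lastEmb hc) fun j => X j.castSucc - lastEmb (gc j)

/-- The ideal generated by `h, x₁ - g₁, …, x_{n-1} - g_{n-1}`. -/
def triIdeal (hc : Fin e → k) (gc : Fin N → Fin e → k) : Ideal (MvPolynomial (Fin (N + 1)) k) :=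
  Ideal.span (Set.range (triBasis hc gc))

variable {hc : Fin e → k} {gc : Fin N → Fin e → k}

lemma triBasis_mem (i : Fin (N + 1)) : triBasis hc gc i ∈ triIdeal hc gc :=
  Ideal.subset_span ⟨i, rfl⟩

/-- The substitution x_j ↦ g_j sends the ideal into the multiples of h in k[x_n] and fixes
polynomials in x_n. A multiple of a monic polynomial of degree `e` that has degree less than `e` is
zero. -/
lemma eq_zero_of_lastEmb_mem {v : Fin e → k} (h : lastEmb v ∈ triIdeal hc gc) : v = 0 := by
  let U : (Fin e → k) → Polynomial k :=
    fun w => ∑ a : Fin e, Polynomial.C (w a) * Polynomial.X ^ (a : ℕ)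
  have hU : ∀ w, (U w).degree < e := fun w => Polynomial.degree_sum_fin_lt w
  let φ : MvPolynomial (Fin (N + 1)) k →ₐ[k] Polynomial k :=
    aeval (Fin.lastCases Polynomial.X fun j => U (gc j))
  have hφ : ∀ w : Fin e → k, φ (lastEmb w) = U w := by
    intro w
    simp [lastEmb_apply, φ, U, Polynomial.C_eq_algebraMap]
  have hI : triIdeal hc gc ≤ Ideal.comap φ.toRingHom (Ideal.span {Polynomial.X ^ e + U hc}) := by
    refine Ideal.span_le.2 ?_
    rintro _ ⟨i, rfl⟩
    rw [SetLike.mem_coe, Ideal.mem_comap, Ideal.mem_span_singleton]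
    refine Fin.cases ?_ (fun j => ?_) i
    · simp only [triBasis, Fin.cons_zero, AlgHom.toRingHom_eq_coe, RingHom.coe_coe, map_add,
        map_pow, hφ]
      simp [φ]
    · simp only [triBasis, Fin.cons_succ, AlgHom.toRingHom_eq_coe, RingHom.coe_coe, map_sub, hφ]
      simp [φ]
  have hdvd : Polynomial.X ^ e + U hc ∣ U v := by
    have := hI h
    rw [Ideal.mem_comap, Ideal.mem_span_singleton] at this
    simpa [hφ] using this
  have hdeg : (Polynomial.X ^ e + U hc).degree = (e : WithBot ℕ) := by
    rw [Polynomial.degree_add_eq_left_of_degree_lt] <;> simp [hU]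
  have h0 : U v = 0 := Polynomial.eq_zero_of_dvd_of_degree_lt hdvd (by rw [hdeg]; exact hU v)
  ext i
  have := congrArg (fun p => Polynomial.coeff p (i : ℕ)) h0
  simpa [U, Polynomial.finsetSum_coeff, Polynomial.coeff_X_pow, Fin.val_inj] using this

/-- `v` is the vector of coefficients of the normal form of `p`. -/
def IsNF (hc : Fin e → k) (gc : Fin N → Fin e → k) (p : MvPolynomial (Fin (N + 1)) k)
    (v : Fin e → k) : Prop :=
  p - lastEmb v ∈ triIdeal hc gc

lemma isNF_zero : IsNF hc gc 0 0 := by simp [IsNF]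

lemma IsNF.add {p q : MvPolynomial (Fin (N + 1)) k} {v w : Fin e → k} (hp : IsNF hc gc p v)
    (hq : IsNF hc gc q w) : IsNF hc gc (p + q) (v + w) := by
  have := (triIdeal hc gc).add_mem hp hq
  rw [IsNF, map_add]
  convert this using 1
  ring

lemma IsNF.smul {p : MvPolynomial (Fin (N + 1)) k} {v : Fin e → k} (hp : IsNF hc gc p v) (c : k) :
    IsNF hc gc (c • p) (c • v) := by
  have := (triIdeal hc gc).mul_mem_left (C c) hp
  rw [IsNF, map_smul, smul_eq_C_mul, smul_eq_C_mul]
  convert this using 1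
  ring

lemma IsNF.sub {p q : MvPolynomial (Fin (N + 1)) k} {v w : Fin e → k} (hp : IsNF hc gc p v)
    (hq : IsNF hc gc q w) : IsNF hc gc (p - q) (v - w) := by
  have := (triIdeal hc gc).sub_mem hp hq
  rw [IsNF, map_sub]
  convert this using 1
  ring

lemma IsNF.congr {p q : MvPolynomial (Fin (N + 1)) k} {v : Fin e → k} (hp : IsNF hc gc p v)
    (hq : q - p ∈ triIdeal hc gc) : IsNF hc gc q v := by
  have := (triIdeal hc gc).add_mem hp hq
  rw [IsNF]
  convert this using 1
  ring

lemma IsNF.unique {p : MvPolynomial (Fin (N + 1)) k} {v w : Fin e → k} (hp : IsNF hc gc p v)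
    (hq : IsNF hc gc p w) : v = w := by
  refine sub_eq_zero.1 (eq_zero_of_lastEmb_mem (hc := hc) (gc := gc) ?_)
  have := (triIdeal hc gc).sub_mem hq hp
  rw [map_sub]
  convert this using 1
  ring

lemma isNF_zero_iff {p : MvPolynomial (Fin (N + 1)) k} :
    IsNF hc gc p 0 ↔ p ∈ triIdeal hc gc := by simp [IsNF]

lemma isNF_mulLast {p : MvPolynomial (Fin (N + 1)) k} {v : Fin e → k} (hp : IsNF hc gc p v) :
    IsNF hc gc (X (Fin.last N) * p) (mulLast hc v).val := by
  refine IsNF.congr (p := X (Fin.last N) * lastEmb v) ?_ ?_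
  · cases e with
    -- For `e = 0` the polynomial h is 1, so the ideal is everything.
    | zero =>
      have h0 : triBasis hc gc 0 = 1 := by simp [triBasis, lastEmb_apply]
      have := triBasis_mem (hc := hc) (gc := gc) 0
      rw [h0, ← Ideal.eq_top_iff_one] at this
      rw [IsNF, this]
      trivial
    | succ e =>
      -- Shifting the coefficients produces the overflow v_{e-1} x_n^e, which is removed by
      -- subtracting v_{e-1} h.
      have key : X (Fin.last N) * lastEmb v - lastEmb (mulLast hc v).val =
          C (v (Fin.last e)) * triBasis hc gc 0 := by
        have hval : ∀ i : Fin (e + 1), (mulLast hc v).val i =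
            (if (i : ℕ) = 0 then 0 else v ⟨i - 1, by have := i.2; omega⟩) -
              v (Fin.last e) * hc i := fun i => rfl
        simp only [triBasis, Fin.cons_zero, lastEmb_apply, hval, map_sub, sub_mul, map_mul,
          Finset.sum_sub_distrib, mul_add, Finset.mul_sum]
        rw [Fin.sum_univ_castSucc (fun i : Fin (e + 1) => X (Fin.last N) * _),
          Fin.sum_univ_succ (fun i : Fin (e + 1) => C (if (i : ℕ) = 0 then _ else _) * _)]
        have h1 : ∀ i : Fin e, X (Fin.last N) *
            (C (v i.castSucc) * X (Fin.last N) ^ (i.castSucc : ℕ)) =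
            C (if ((i.succ : Fin (e + 1)) : ℕ) = 0 then 0 else
              v ⟨(i.succ : Fin (e + 1)) - 1, by have := i.2; simp⟩) *
              (X (Fin.last N) : MvPolynomial (Fin (N + 1)) k) ^ ((i.succ : Fin (e + 1)) : ℕ) := by
          intro i
          simp only [Fin.val_succ, Nat.succ_ne_zero, if_false, Nat.add_sub_cancel, Fin.val_castSucc]
          rw [show v ⟨(i : ℕ), by have := i.2; omega⟩ = v i.castSucc from rfl]
          ring
        rw [Finset.sum_congr rfl fun i _ => h1 i]
        simp only [Fin.val_zero, if_true, map_zero, zero_mul, Fin.val_last]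
        have h2 : ∑ i, C (v (Fin.last e)) * (C (hc i) * X (Fin.last N) ^ (i : ℕ)) =
          ∑ i, C (v (Fin.last e)) * C (hc i) *
            (X (Fin.last N) : MvPolynomial (Fin (N + 1)) k) ^ (i : ℕ) :=
          Finset.sum_congr rfl fun i _ => by ring
        rw [h2]
        ring
      rw [IsNF, key]
      exact Ideal.mul_mem_left _ _ (triBasis_mem 0)
  · rw [← mul_sub]
    exact Ideal.mul_mem_left _ _ hp

lemma isNF_pow_mul {p : MvPolynomial (Fin (N + 1)) k} {v : Fin e → k} (hp : IsNF hc gc p v)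
    (a : ℕ) : IsNF hc gc (X (Fin.last N) ^ a * p) ((fun w => (mulLast hc w).val)^[a] v) := by
  induction a with
  | zero => simpa using hp
  | succ a ih =>
    rw [Function.iterate_succ_apply', pow_succ', mul_assoc]
    exact isNF_mulLast ih

lemma IsNF.sum {ι : Type*} (s : Finset ι) {p : ι → MvPolynomial (Fin (N + 1)) k}
    {v : ι → Fin e → k} (h : ∀ i ∈ s, IsNF hc gc (p i) (v i)) :
    IsNF hc gc (∑ i ∈ s, p i) (∑ i ∈ s, v i) := by
  rw [IsNF, map_sum, ← Finset.sum_sub_distrib]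
  exact Ideal.sum_mem _ h

lemma isNF_one (he : 0 < e) : IsNF hc gc 1 oneVec := by
  have : (lastEmb (oneVec : Fin e → k) : MvPolynomial (Fin (N + 1)) k) = 1 := by
    rw [lastEmb_apply, Finset.sum_eq_single ⟨0, he⟩]
    · simp [oneVec]
    · intro b _ hb
      have : (b : ℕ) ≠ 0 := fun h => hb (Fin.ext h)
      simp [oneVec, this]
    · simp
  rw [IsNF, this]
  simp

lemma X_castSucc_sub_mem (j : Fin N) : X j.castSucc - lastEmb (gc j) ∈ triIdeal hc gc := by
  simpa [triBasis] using triBasis_mem (hc := hc) (gc := gc) j.succ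

/-- Multiplication by x_n preserves the existence of normal forms by `isNF_mulLast`. Multiplication
by another variable x_j is congruent to multiplication by g_j, a combination of powers of x_n. -/
lemma exists_isNF (he : 0 < e) (p : MvPolynomial (Fin (N + 1)) k) : ∃ v, IsNF hc gc p v := by
  have hlast : ∀ p : MvPolynomial (Fin (N + 1)) k, (∃ v, IsNF hc gc p v) → ∀ a : ℕ,
      ∃ v, IsNF hc gc (X (Fin.last N) ^ a * p) v := fun p ⟨v, hv⟩ a => ⟨_, isNF_pow_mul hv a⟩
  induction p using MvPolynomial.induction_on with
  | C c =>
    refine ⟨c • oneVec, ?_⟩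
    have := (isNF_one (hc := hc) (gc := gc) he).smul c
    rwa [smul_eq_C_mul, mul_one] at this
  | add p q hp hq =>
    obtain ⟨v, hv⟩ := hp
    obtain ⟨w, hw⟩ := hq
    exact ⟨_, hv.add hw⟩
  | mul_X p i hp =>
    rw [mul_comm]
    refine Fin.lastCases ?_ (fun j => ?_) i
    · simpa using hlast p hp 1
    · have h1 : ∃ v, IsNF hc gc (lastEmb (gc j) * p) v := by
        choose v hv using hlast p hp
        refine ⟨∑ a : Fin e, gc j a • v a, ?_⟩
        have := IsNF.sum (Finset.univ : Finset (Fin e)) fun a _ => (hv (a : ℕ)).smul (gc j a)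
        convert this using 1
        simp [lastEmb_apply, Finset.sum_mul, smul_eq_C_mul, mul_assoc]
      obtain ⟨v, hv⟩ := h1
      refine ⟨v, hv.congr ?_⟩
      rw [← sub_mul]
      exact Ideal.mul_mem_right _ _ (X_castSucc_sub_mem j)

lemma triIdeal_ne_top (he : 0 < e) : triIdeal hc gc ≠ ⊤ := by
  intro h
  have h1 : IsNF hc gc 1 0 := by
    rw [isNF_zero_iff, h]
    trivial
  have := congrFun ((isNF_one he).unique h1) ⟨0, he⟩
  simp [oneVec] at this

lemma isZeroDimensional_triIdeal (he : 0 < e) : IsZeroDimensional (triIdeal hc gc) := by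
  let f : (Fin e → k) →ₗ[k] MvPolynomial (Fin (N + 1)) k ⧸ triIdeal hc gc :=
    (Ideal.Quotient.mkₐ k (triIdeal hc gc)).toLinearMap ∘ₗ lastEmb
  refine Module.Finite.of_surjective f fun q => ?_
  obtain ⟨p, rfl⟩ := Ideal.Quotient.mk_surjective q
  obtain ⟨v, hv⟩ := exists_isNF (hc := hc) (gc := gc) he p
  exact ⟨v, (Ideal.Quotient.eq.2 hv).symm⟩

/-- More than `e` monomials are linearly dependent modulo the ideal. -/
lemma exists_mem_triIdeal_support_subset (he : 0 < e) (T : Finset (Fin (N + 1) →₀ ℕ))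
    (hT : e < T.card) : ∃ f ∈ triIdeal hc gc, f ≠ 0 ∧ f.support ⊆ T := by
  classical
  choose v hv using fun a : Fin (N + 1) →₀ ℕ => exists_isNF (hc := hc) (gc := gc) he (monomial a 1)
  -- More than `e` normal forms cannot be independent in k^e.
  have hdep : ∃ c : (Fin (N + 1) →₀ ℕ) → k, ∑ a ∈ T, c a • v a = 0 ∧ ∃ a ∈ T, c a ≠ 0 := by
    by_contra! hcon
    have hli : LinearIndepOn k v (T : Set (Fin (N + 1) →₀ ℕ)) := linearIndepOn_finset_iff.2 hcon
    have := LinearIndependent.fintype_card_le_finrank hli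
    simp at this
    omega
  obtain ⟨c, hc0, a, ha, hca⟩ := hdep
  refine ⟨∑ a ∈ T, c a • monomial a 1, ?_, ?_, ?_⟩
  · rw [← isNF_zero_iff, ← hc0]
    exact IsNF.sum T fun a _ => (hv a).smul (c a)
  · intro h
    apply hca
    have := congrArg (coeff a) h
    simpa [coeff_sum, coeff_monomial, ha] using this
  · intro b hb
    by_contra hbT
    rw [mem_support_iff] at hb
    apply hb
    simp [coeff_sum, coeff_monomial, hbT]

end TriangularIdeal

/-! ### The triangular basis as reduced lexicographic Gröbner basis -/

section TriangularBasis

variable {k : Type*} [Field k] {N e : ℕ} {hc : Fin e → k} {gc : Fin N → Fin e → k}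
  {ord : MonomialOrder (Fin (N + 1))}

/-- A Gröbner basis contains elements whose leading terms are powers of the different variables. -/
lemma IsGroebnerBasis.le_card (he : 0 < e) {G : Finset (MvPolynomial (Fin (N + 1)) k)}
    (hG : IsGroebnerBasis ord G (triIdeal hc gc)) : N + 1 ≤ G.card := by
  classical
  have key : ∀ j : Fin (N + 1), ∃ g ∈ G, ∃ b, b ≠ 0 ∧ ord.degree g = Finsupp.single j b := by
    intro j
    -- The `e + 1` powers 1, x_j, …, x_j^e are dependent modulo the ideal. A leading term dividing
    -- that of `f` is therefore itself a power of x_j.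
    obtain ⟨f, hfI, hf0, hfT⟩ := exists_mem_triIdeal_support_subset (hc := hc) (gc := gc) he
      ((Finset.range (e + 1)).image fun b => Finsupp.single j b)
      (by rw [Finset.card_image_of_injective _ (Finsupp.single_injective j)]; simp)
    obtain ⟨g, hgG, hg0, hle⟩ := hG.exists_degree_le hfI hf0
    obtain ⟨b, -, hb⟩ := Finset.mem_image.1 (hfT (ord.degree_mem_support hf0))
    rw [← hb] at hle
    have hgj : ord.degree g = Finsupp.single j (ord.degree g j) := by
      ext i
      by_cases hij : i = j
      · simp [hij]
      · have := hle i
        rw [Finsupp.single_eq_of_ne hij] at this ⊢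
        omega
    refine ⟨g, hgG, ord.degree g j, fun h0 => ?_, hgj⟩
    -- With exponent zero, `g` would be a nonzero constant in a proper ideal.
    rw [h0, Finsupp.single_zero] at hgj
    refine triIdeal_ne_top (hc := hc) (gc := gc) he ?_
    have hgI := hG.1 hgG
    rw [ord.eq_C_of_degree_eq_zero hgj, SetLike.mem_coe] at hgI
    refine Ideal.eq_top_of_isUnit_mem _ hgI (IsUnit.map C ?_)
    exact (isUnit_iff_ne_zero.2 (ord.leadingCoeff_ne_zero_iff.2 hg0))
  choose g hgG b hb0 hdeg using key
  have hinj : Function.Injective g := by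
    intro i j hij
    have h := hdeg i
    rw [hij, hdeg j] at h
    by_contra hne
    have := DFunLike.congr_fun h i
    rw [Finsupp.single_eq_same, Finsupp.single_eq_of_ne hne] at this
    exact hb0 i this.symm
  calc N + 1 = (Finset.univ.image g).card := by
        rw [Finset.card_image_of_injective _ hinj]; simp
    _ ≤ G.card := Finset.card_le_card (Finset.image_subset_iff.2 fun i _ => hgG i)

/-- The exponents of the leading terms of the triangular basis. -/
def triDegree (N e : ℕ) : Fin (N + 1) → Fin (N + 1) →₀ ℕ :=
  Fin.cons (Finsupp.single (Fin.last N) e) fun j => Finsupp.single j.castSucc 1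

lemma exists_of_mem_support_triBasis {i : Fin (N + 1)} {a : Fin (N + 1) →₀ ℕ}
    (ha : a ∈ (triBasis hc gc i).support) :
    a = triDegree N e i ∨ ∃ b : Fin e, a = Finsupp.single (Fin.last N) (b : ℕ) := by
  classical
  revert ha
  refine Fin.cases ?_ (fun j => ?_) i
  · simp only [triBasis, triDegree, Fin.cons_zero]
    intro ha
    rcases Finset.mem_union.1 (support_add ha) with h | h
    · rw [X_pow_eq_monomial] at h
      exact Or.inl (by simpa using support_monomial_subset h)
    · exact Or.inr (exists_of_mem_support_lastEmb h)
  · simp only [triBasis, triDegree, Fin.cons_succ]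
    intro ha
    rcases Finset.mem_union.1 (support_sub _ _ _ ha) with h | h
    · exact Or.inl (by simpa [X] using support_monomial_subset h)
    · exact Or.inr (exists_of_mem_support_lastEmb h)

lemma triDegree_le_triDegree {i j : Fin (N + 1)} (he : 0 < e)
    (h : triDegree N e i ≤ triDegree N e j) : i = j := by
  revert h
  refine Fin.cases ?_ (fun i => ?_) i <;> refine Fin.cases ?_ (fun j => ?_) j
  · simp
  · intro h
    have := h (Fin.last N)
    simp [triDegree, (Fin.castSucc_lt_last j).ne] at this
    omega
  · intro h
    have := h i.castSucc
    simp [triDegree] at this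
  · intro h
    have := h i.castSucc
    simp only [triDegree, Fin.cons_succ, Finsupp.single_eq_same, Finsupp.single_apply,
      Fin.castSucc_inj] at this
    split_ifs at this with h
    · rw [h]
    · omega

lemma not_triDegree_le_single {i : Fin (N + 1)} {b : Fin e} :
    ¬ triDegree N e i ≤ Finsupp.single (Fin.last N) (b : ℕ) := by
  refine Fin.cases ?_ (fun i => ?_) i
  · intro h
    have := h (Fin.last N)
    simp [triDegree] at this
    have := b.2
    omega
  · intro h
    have := h i.castSucc
    simp [triDegree] at this

lemma coeff_triBasis (i : Fin (N + 1)) : coeff (triDegree N e i) (triBasis hc gc i) = 1 := by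
  classical
  have h0 : ∀ v : Fin e → k, coeff (triDegree N e i)
      (lastEmb v : MvPolynomial (Fin (N + 1)) k) = 0 := by
    intro v
    by_contra h
    obtain ⟨b, hb⟩ := exists_of_mem_support_lastEmb (mem_support_iff.2 h)
    exact not_triDegree_le_single (b := b) hb.le
  revert h0
  refine Fin.cases ?_ (fun j => ?_) i
  · intro h0
    simp only [triBasis, triDegree, Fin.cons_zero, coeff_add] at h0 ⊢
    rw [h0, X_pow_eq_monomial, coeff_monomial]
    simp
  · intro h0
    simp only [triBasis, triDegree, Fin.cons_succ, coeff_sub] at h0 ⊢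
    rw [h0, X, coeff_monomial]
    simp

/-- The only property of the lexicographic order needed here is that every power of x_n is smaller
than every other variable. -/
lemma degree_triBasis (hlex : ∀ (j : Fin N) (a : ℕ),
    ord.toSyn (Finsupp.single (Fin.last N) a) < ord.toSyn (Finsupp.single j.castSucc 1))
    (i : Fin (N + 1)) : ord.degree (triBasis hc gc i) = triDegree N e i := by
  refine degree_eq_of_le (by simp [mem_support_iff, coeff_triBasis]) fun b hb => ?_
  rcases exists_of_mem_support_triBasis hb with rfl | ⟨b, rfl⟩
  · exact le_rfl
  · refine Fin.cases ?_ (fun j => ?_) i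
    · refine ord.toSyn_monotone ?_
      simp only [triDegree, Fin.cons_zero]
      exact Finsupp.single_mono b.2.le
    · exact (hlex j b).le

lemma triBasis_injective (he : 0 < e) : Function.Injective (triBasis hc gc) := by
  intro i j hij
  have h : triDegree N e i ∈ (triBasis hc gc j).support := by
    rw [← hij]
    simp [mem_support_iff, coeff_triBasis]
  rcases exists_of_mem_support_triBasis h with h | ⟨b, h⟩
  · exact triDegree_le_triDegree he h.le
  · exact absurd h.le not_triDegree_le_single

open Classical in
lemma isReducedGroebnerBasis_triBasis (he : 0 < e) (hlex : ∀ (j : Fin N) (a : ℕ),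
    ord.toSyn (Finsupp.single (Fin.last N) a) < ord.toSyn (Finsupp.single j.castSucc 1)) :
    IsReducedGroebnerBasis ord (Finset.univ.image (triBasis hc gc)) (triIdeal hc gc) := by
  refine isReducedGroebnerBasis_of_remainder_eq_zero ?_ ?_ ?_ ?_
  · intro g hg
    obtain ⟨i, -, rfl⟩ := Finset.mem_image.1 hg
    exact triBasis_mem i
  · intro g hg
    obtain ⟨i, -, rfl⟩ := Finset.mem_image.1 hg
    rw [MonomialOrder.leadingCoeff, degree_triBasis hlex, coeff_triBasis]
  · intro g hg a ha g' hg' hne hle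
    obtain ⟨i, -, rfl⟩ := Finset.mem_image.1 hg
    obtain ⟨j, -, rfl⟩ := Finset.mem_image.1 hg'
    rw [degree_triBasis hlex] at hle
    rcases exists_of_mem_support_triBasis ha with rfl | ⟨b, rfl⟩
    · exact hne (congrArg _ (triDegree_le_triDegree he hle))
    · exact not_triDegree_le_single hle
  · intro r hr hsupp
    -- The terms divisible by none of x_1, …, x_{n-1}, x_n^e are the powers of x_n below `e`, so `r`
    -- is its own normal form.
    have hsupp' : ∀ a ∈ r.support, ∃ b : Fin e, a = Finsupp.single (Fin.last N) (b : ℕ) := by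
      intro a ha
      have h : ∀ i, ¬ triDegree N e i ≤ a := by
        intro i
        have := hsupp a ha (triBasis hc gc i) (Finset.mem_image_of_mem _ (Finset.mem_univ i))
        rwa [degree_triBasis hlex] at this
      have hz : ∀ j : Fin N, a j.castSucc = 0 := by
        intro j
        by_contra hj
        refine h j.succ ?_
        simp only [triDegree, Fin.cons_succ, Finsupp.single_le_iff]
        omega
      have hl : a (Fin.last N) < e := by
        by_contra hj
        refine h 0 ?_
        simp only [triDegree, Fin.cons_zero, Finsupp.single_le_iff]
        omega
      refine ⟨⟨a (Fin.last N), hl⟩, ?_⟩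
      ext i
      refine Fin.lastCases ?_ (fun j => ?_) i
      · simp
      · simp [hz]
    have hrv : r = lastEmb fun b : Fin e => coeff (Finsupp.single (Fin.last N) (b : ℕ)) r := by
      ext a
      by_cases ha : ∃ b : Fin e, a = Finsupp.single (Fin.last N) (b : ℕ)
      · obtain ⟨b, rfl⟩ := ha
        rw [coeff_lastEmb_single]
      · have h1 : a ∉ r.support := fun h => ha (hsupp' a h)
        have h2 : a ∉ (lastEmb fun b : Fin e =>
            coeff (Finsupp.single (Fin.last N) (b : ℕ)) r : MvPolynomial (Fin (N + 1)) k).support :=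
          fun h => ha (exists_of_mem_support_lastEmb h)
        rw [notMem_support_iff.1 h1, notMem_support_iff.1 h2]
    rw [hrv] at hr
    rw [hrv, eq_zero_of_lastEmb_mem hr, map_zero]

lemma IsLex.single_last_lt (h : IsLex ord) (j : Fin N) (a : ℕ) :
    ord.toSyn (Finsupp.single (Fin.last N) a) < ord.toSyn (Finsupp.single j.castSucc 1) := by
  rw [← not_le, h, not_le, MonomialOrder.lex_lt_iff, Finsupp.Lex.lt_iff]
  refine ⟨j.castSucc, fun i hi => ?_, ?_⟩
  · have h1 : i ≠ Fin.last N := (hi.trans (Fin.castSucc_lt_last j)).ne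
    simp [h1.symm, hi.ne']
  · simp

lemma isInShapePosition_triIdeal (he : 0 < e) : IsInShapePosition (triIdeal hc gc) := by
  classical
  let U : (Fin e → k) → Polynomial k :=
    fun w => ∑ a : Fin e, Polynomial.C (w a) * Polynomial.X ^ (a : ℕ)
  have hU : ∀ w, (inLastVar (U w) : MvPolynomial (Fin (N + 1)) k) = lastEmb w := by
    intro w
    simp [U, inLastVar, lastEmb_apply, algebraMap_eq]
  refine ⟨Polynomial.X ^ e + U hc, fun j => U (gc j), Finset.univ.image (triBasis hc gc), ?_,
    isReducedGroebnerBasis_triBasis he (IsLex.single_last_lt fun _ _ => Iff.rfl)⟩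
  have h0 : (inLastVar (Polynomial.X ^ e + U hc) : MvPolynomial (Fin (N + 1)) k) =
      X (Fin.last N) ^ e + lastEmb hc := by
    rw [← hU hc]
    simp [inLastVar]
  simp only [h0, hU, Finset.coe_image, Finset.coe_univ, Set.image_univ]
  rw [triBasis, Fin.range_cons]

end TriangularBasis

/-! ### Values and costs of composed computations -/

namespace Timed

variable {α β ι : Type*}

section
variable {α β : Type u}
@[simp] lemma val_bind (x : Timed α) (f : α → Timed β) : (x >>= f).val = (f x.val).val := rfl
@[simp] lemma cost_bind (x : Timed α) (f : α → Timed β) :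
    (x >>= f).cost = x.cost + (f x.val).cost := rfl
@[simp] lemma val_pure (a : α) : (pure a : Timed α).val = a := rfl
@[simp] lemma cost_pure (a : α) : (pure a : Timed α).cost = 0 := rfl
end
@[simp] lemma val_charge (c : ℕ) (a : α) : (charge c a).val = a := rfl
@[simp] lemma cost_charge (c : ℕ) (a : α) : (charge c a).cost = c := rfl
@[simp] lemma val_all [Fintype ι] (x : ι → Timed α) : (Timed.all x).val = fun i => (x i).val := rfl
@[simp] lemma cost_all [Fintype ι] (x : ι → Timed α) : (Timed.all x).cost = ∑ i, (x i).cost := rfl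

end Timed

/-! ### Multiplication tables and echelon reduction -/

section FGLMPrimitives

variable {k : Type*} [Field k] {N e : ℕ} {hc : Fin e → k} {gc : Fin N → Fin e → k}

lemma vecSubMul_val (v : Fin e → k) (c : k) (w : Fin e → k) :
    (vecSubMul v c w).val = v - c • w := by
  ext i; simp [vecSubMul, fieldMul, fieldSub]

lemma vecSubMul_cost (v : Fin e → k) (c : k) (w : Fin e → k) : (vecSubMul v c w).cost = e * 2 := by
  simp [vecSubMul, fieldMul, fieldSub]

lemma vecAddMul_val (v : Fin e → k) (c : k) (w : Fin e → k) :
    (vecAddMul v c w).val = v + c • w := by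
  ext i; simp [vecAddMul, fieldMul, fieldAdd]

lemma vecAddMul_cost (v : Fin e → k) (c : k) (w : Fin e → k) : (vecAddMul v c w).cost = e * 2 := by
  simp [vecAddMul, fieldMul, fieldAdd]

lemma vecScale_val (c : k) (v : Fin e → k) : (vecScale c v).val = c • v := by
  ext i; simp [vecScale, fieldMul]

lemma vecScale_cost (c : k) (v : Fin e → k) : (vecScale c v).cost = e := by
  simp [vecScale, fieldMul]

lemma mulLast_cost (v : Fin e → k) : (mulLast hc v).cost = e * 2 := by
  simp [mulLast, fieldMul, fieldSub]

lemma linComb_cost_le (cs : List k) (vs : List (Fin e → k)) :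
    (linComb cs vs).cost ≤ cs.length * (e * 2) := by
  induction cs generalizing vs with
  | nil => simp [linComb]
  | cons c cs ih =>
    cases vs with
    | nil => simp [linComb]
    | cons v vs =>
      simp only [linComb, cost_bind, vecAddMul_cost, List.length_cons]
      have := ih vs
      linarith

lemma powersTimes_cost (r : ℕ) (v : Fin e → k) : (powersTimes hc r v).cost = r * (e * 2) := by
  induction r generalizing v with
  | zero => simp [powersTimes]
  | succ r ih => simp [powersTimes, ih, mulLast_cost]; ring

/-- Induction on the length: the tail of the table for p is the table for x_n p, and the head
contributes the constant coefficient. -/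
lemma isNF_linComb_powersTimes {r : ℕ} (c : Fin r → k) {p : MvPolynomial (Fin (N + 1)) k}
    {w : Fin e → k} (hw : IsNF hc gc p w) :
    IsNF hc gc ((∑ a, C (c a) * X (Fin.last N) ^ (a : ℕ)) * p)
      (linComb (List.ofFn c) (powersTimes hc r w).val).val := by
  induction r generalizing p w with
  | zero => simpa [powersTimes, linComb] using isNF_zero
  | succ r ih =>
    have h1 := (ih (fun i => c i.succ) (isNF_mulLast hw)).add (hw.smul (c 0))
    rw [List.ofFn_succ]
    simp only [powersTimes, linComb, val_bind, val_pure, vecAddMul_val]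
    convert h1 using 1
    rw [Fin.sum_univ_succ, add_mul, Finset.sum_mul, Finset.sum_mul, smul_eq_C_mul,
      add_comm (Finset.sum _ _)]
    congr 1
    · simp
    · refine Finset.sum_congr rfl fun i _ => ?_
      rw [Fin.val_succ]
      ring

lemma isNF_varVec (he : 0 < e) (j : Fin (N + 1)) :
    IsNF hc gc (X j) (varVec hc gc j).val := by
  refine Fin.lastCases ?_ (fun j => ?_) j
  · simpa [varVec] using isNF_mulLast (isNF_one (hc := hc) (gc := gc) he)
  · simpa [varVec, IsNF] using X_castSucc_sub_mem (hc := hc) (gc := gc) j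

lemma varVec_cost_le (j : Fin (N + 1)) : (varVec hc gc j).cost ≤ e * 2 := by
  refine Fin.lastCases ?_ (fun j => ?_) j
  · simp [varVec, mulLast_cost]
  · simp [varVec]

lemma multTables_cost_le :
    (multTables hc gc).cost ≤ (N + 1) * (e * 2 + e * (e * 2)) := by
  simp only [multTables, cost_all, cost_bind, powersTimes_cost]
  refine (Finset.sum_le_sum fun j _ =>
    Nat.add_le_add_right (varVec_cost_le (hc := hc) (gc := gc) j) _).trans ?_
  simp

/-- Since p is congruent to ∑ v_a x_n^a, the product x_j p is congruent to ∑ v_a x_j x_n^a, whose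
summands are tabulated. -/
lemma isNF_linComb_multTables (he : 0 < e) (j : Fin (N + 1)) {p : MvPolynomial (Fin (N + 1)) k}
    {v : Fin e → k} (hv : IsNF hc gc p v) :
    IsNF hc gc (X j * p) (linComb (List.ofFn v) ((multTables hc gc).val j)).val := by
  have h1 := isNF_linComb_powersTimes v (isNF_varVec (hc := hc) (gc := gc) he j)
  refine h1.congr ?_
  rw [← lastEmb_apply, mul_comm, ← sub_mul]
  exact Ideal.mul_mem_right _ _ hv

lemma echReduce_cost_le {D : ℕ} (E : List (Fin e × (Fin e → k) × MvPolynomial (Fin (N + 1)) k))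
    (hE : ∀ r ∈ E, r.2.2.support.card ≤ D) (v : Fin e → k) (q : MvPolynomial (Fin (N + 1)) k) :
    (echReduce E v q).cost ≤ E.length * (e * 2 + 2 * D) := by
  induction E generalizing v q with
  | nil => simp [echReduce]
  | cons r E ih =>
    obtain ⟨p, w, r⟩ := r
    simp only [List.mem_cons, forall_eq_or_imp] at hE
    have := ih hE.2 (vecSubMul v (v p) w).val (polySubMul q (v p) r).val
    simp only [echReduce, cost_bind, vecSubMul_cost, List.length_cons]
    have h2 : (polySubMul q (v p) r).cost ≤ 2 * D := by
      simpa [polySubMul] using hE.1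
    linarith

/-- The properties of the rows of an echelon form of the normal forms of `std`. -/
structure IsEchelon (hc : Fin e → k) (gc : Fin N → Fin e → k) (std : Finset (Fin (N + 1) →₀ ℕ))
    (E : List (Fin e × (Fin e → k) × MvPolynomial (Fin (N + 1)) k)) : Prop where
  nf : ∀ r ∈ E, IsNF hc gc r.2.2 r.2.1
  pivot : ∀ r ∈ E, r.2.1 r.1 = 1
  pairwise : E.Pairwise fun r r' => r'.2.1 r.1 = 0
  supp : ∀ r ∈ E, r.2.2.support ⊆ std

/-- Pivots are distinct, because a row is 1 at its own pivot and 0 at all earlier ones. This is what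
bounds the number of standard terms by `e`. -/
lemma IsEchelon.length_le {std : Finset (Fin (N + 1) →₀ ℕ)}
    {E : List (Fin e × (Fin e → k) × MvPolynomial (Fin (N + 1)) k)}
    (hE : IsEchelon hc gc std E) : E.length ≤ e := by
  have h : (E.map Prod.fst).Nodup := by
    rw [List.Nodup, List.pairwise_map]
    refine List.Pairwise.imp_of_mem ?_ hE.pairwise
    intro r r' _ hr' h heq
    rw [heq, hE.pivot r' hr'] at h
    exact one_ne_zero h
  simpa using h.length_le_card

/-- The last conclusion makes the induction work: once a row has cleared its pivot entry, the later
rows vanish there and leave that entry zero. Coefficients outside `std` survive because every row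
comes from a polynomial supported on `std`. -/
lemma echReduce_spec {std : Finset (Fin (N + 1) →₀ ℕ)}
    {E : List (Fin e × (Fin e → k) × MvPolynomial (Fin (N + 1)) k)}
    (hE : IsEchelon hc gc std E) {v : Fin e → k} {q : MvPolynomial (Fin (N + 1)) k}
    (hq : IsNF hc gc q v) :
    IsNF hc gc (echReduce E v q).val.2 (echReduce E v q).val.1 ∧
      (∀ r ∈ E, (echReduce E v q).val.1 r.1 = 0) ∧
      (∀ a ∉ std, coeff a (echReduce E v q).val.2 = coeff a q) ∧
      ∀ p, v p = 0 → (∀ r ∈ E, r.2.1 p = 0) → (echReduce E v q).val.1 p = 0 := by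
  induction E generalizing v q with
  | nil => simpa [echReduce] using hq
  | cons r E ih =>
    obtain ⟨p, w, r⟩ := r
    obtain ⟨h1, h2, h3, h4⟩ := hE
    simp only [List.mem_cons, forall_eq_or_imp, List.pairwise_cons] at h1 h2 h3 h4
    obtain ⟨i1, i2, i3, i4⟩ := ih ⟨h1.2, h2.2, h3.2, h4.2⟩ (hq.sub (h1.1.smul (v p)))
    simp only [echReduce, val_bind, vecSubMul_val, polySubMul, val_charge, List.mem_cons,
      forall_eq_or_imp]
    refine ⟨i1, ⟨i4 p (by simp [h2.1]) h3.1, i2⟩, ?_, ?_⟩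
    · intro a ha
      rw [i3 a ha]
      have : coeff a r = 0 := notMem_support_iff.1 fun h => ha (h4.1 h)
      simp [this]
    · intro p' hp' hall
      exact i4 p' (by simp [hp', hall.1]) hall.2

lemma findPivot_none {v : Fin e → k} (h : (findPivot v).val = none) : v = 0 := by
  ext p
  simp only [findPivot, val_charge, Option.map_eq_none_iff, List.find?_eq_none] at h
  simpa using h p (List.mem_finRange p)

lemma findPivot_some {v : Fin e → k} {p : Fin e} {a : k} (h : (findPivot v).val = some (p, a)) :
    v p = a ∧ a ≠ 0 := by
  simp only [findPivot, val_charge, Option.map_eq_some_iff] at h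
  obtain ⟨p', h1, h2⟩ := h
  have := List.find?_some h1
  simp only [Prod.mk.injEq] at h2
  obtain ⟨rfl, rfl⟩ := h2
  exact ⟨rfl, by simpa using this⟩

lemma findPivot_cost (v : Fin e → k) : (findPivot v).cost = e := rfl

end FGLMPrimitives

/-! ### The loop invariant of FGLM -/

section FGLMLoop

variable {k : Type*} [Field k] {N e : ℕ} {hc : Fin e → k} {gc : Fin N → Fin e → k}
  {ord : MonomialOrder (Fin (N + 1))}

/-- A term is a candidate, a standard term, or a multiple of a leading term of the new basis. -/
def FGLMReached (ord : MonomialOrder (Fin (N + 1))) (st : FGLMState k N e)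
    (std : Finset (Fin (N + 1) →₀ ℕ)) (a : Fin (N + 1) →₀ ℕ) : Prop :=
  (∃ v, (a, v) ∈ st.cand) ∨ a ∈ std ∨ ∃ g ∈ st.gb, ord.degree g ≤ a

/-- The invariant of the main loop; `std` is the set of the standard terms found so far. -/
structure FGLMInvariant (ord : MonomialOrder (Fin (N + 1))) (hc : Fin e → k)
    (gc : Fin N → Fin e → k) (st : FGLMState k N e) (std : Finset (Fin (N + 1) →₀ ℕ)) : Prop where
  cand_nf : ∀ c ∈ st.cand, IsNF hc gc (monomial c.1 1) c.2
  std_lt : ∀ c ∈ st.cand, ∀ s ∈ std, ord.toSyn s < ord.toSyn c.1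
  gb_lt : ∀ c ∈ st.cand, ∀ g ∈ st.gb, ord.toSyn (ord.degree g) < ord.toSyn c.1
  ech : IsEchelon hc gc std st.ech
  card_std : std.card = st.ech.length
  indep : ∀ f v, f.support ⊆ std → IsNF hc gc f v → (∀ r ∈ st.ech, v r.1 = 0) → f = 0
  gb_mem : ∀ g ∈ st.gb, g ∈ triIdeal hc gc
  gb_monic : ∀ g ∈ st.gb, ord.leadingCoeff g = 1
  gb_supp : ∀ g ∈ st.gb, ∀ a ∈ g.support, a = ord.degree g ∨ a ∈ std
  std_reduced : ∀ s ∈ std, ∀ g ∈ st.gb, ¬ ord.degree g ≤ s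
  gb_reduced : ∀ g ∈ st.gb, ∀ g' ∈ st.gb, g' ≠ g → ¬ ord.degree g' ≤ ord.degree g
  reached_zero : FGLMReached ord st std 0
  reached_succ : ∀ s ∈ std, ∀ j, FGLMReached ord st std (s + Finsupp.single j 1)

lemma FGLMReached.mono {st st' : FGLMState k N e} {std std' : Finset (Fin (N + 1) →₀ ℕ)}
    {a : Fin (N + 1) →₀ ℕ} (h : FGLMReached ord st std a)
    (hcand : ∀ c ∈ st.cand, FGLMReached ord st' std' c.1) (hstd : std ⊆ std')
    (hgb : ∀ g ∈ st.gb, g ∈ st'.gb) : FGLMReached ord st' std' a := by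
  rcases h with ⟨v, hv⟩ | h | ⟨g, hg, hle⟩
  · exact hcand _ hv
  · exact Or.inr (Or.inl (hstd h))
  · exact Or.inr (Or.inr ⟨g, hgb g hg, hle⟩)

lemma FGLMInvariant.initial (he : 0 < e) :
    FGLMInvariant ord hc gc { cand := [(0, oneVec)], ech := [], gb := [] } ∅ where
  cand_nf := by
    simp only [List.mem_singleton, forall_eq]
    exact isNF_one he
  std_lt := by simp
  gb_lt := by simp
  ech := ⟨by simp, by simp, by simp, by simp⟩
  card_std := by simp
  indep := fun f v hf _ _ => by simpa using hf
  gb_mem := by simp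
  gb_monic := by simp
  gb_supp := by simp
  std_reduced := by simp
  gb_reduced := by simp
  reached_zero := Or.inl ⟨oneVec, by simp⟩
  reached_succ := by simp

section Step

variable {st : FGLMState k N e} {std : Finset (Fin (N + 1) →₀ ℕ)} {t : Fin (N + 1) →₀ ℕ}
  {rest : List ((Fin (N + 1) →₀ ℕ) × (Fin e → k))}

lemma FGLMInvariant.drop (h : FGLMInvariant ord hc gc st std)
    (hrest : ∀ c, c ∈ rest ↔ c ∈ st.cand ∧ c.1 ≠ t)
    (hdiv : ∃ g ∈ st.gb, ord.degree g ≤ t) :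
    FGLMInvariant ord hc gc { st with cand := rest } std := by
  have hcand : ∀ c ∈ st.cand, FGLMReached ord { st with cand := rest } std c.1 := by
    intro c hcm
    by_cases hct : c.1 = t
    · exact Or.inr (Or.inr (hct ▸ hdiv))
    · exact Or.inl ⟨c.2, (hrest c).2 ⟨hcm, hct⟩⟩
  exact
  { h with
    cand_nf := fun c hcm => h.cand_nf c ((hrest c).1 hcm).1
    std_lt := fun c hcm => h.std_lt c ((hrest c).1 hcm).1
    gb_lt := fun c hcm => h.gb_lt c ((hrest c).1 hcm).1
    reached_zero := h.reached_zero.mono hcand (Finset.Subset.refl _) fun _ => id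
    reached_succ := fun s hs j =>
      (h.reached_succ s hs j).mono hcand (Finset.Subset.refl _) fun _ => id }

variable {v v' : Fin e → k} {q : MvPolynomial (Fin (N + 1)) k}

/-- Reduction changes only coefficients at standard terms, all smaller than the candidate `t`, so
`t` remains the leading term, with coefficient 1. -/
lemma coeff_reduced (h : FGLMInvariant ord hc gc st std) (ht : (t, v) ∈ st.cand)
    (hq : ∀ a ∉ std, coeff a q = coeff a (monomial t (1 : k))) :
    t ∉ std ∧ coeff t q = 1 ∧ (∀ a ∈ q.support, a = t ∨ a ∈ std) ∧ ord.degree q = t := by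
  classical
  have htstd : t ∉ std := fun hs => lt_irrefl _ (h.std_lt _ ht t hs)
  have hct : coeff t q = 1 := by rw [hq t htstd]; simp
  have hsupp : ∀ a ∈ q.support, a = t ∨ a ∈ std := by
    intro a ha
    by_contra! hcon
    rw [mem_support_iff, hq a hcon.2, coeff_monomial, if_neg hcon.1.symm] at ha
    exact ha rfl
  refine ⟨htstd, hct, hsupp, degree_eq_of_le (by simp [mem_support_iff, hct]) fun b hb => ?_⟩
  rcases hsupp b hb with rfl | hb
  · exact le_rfl
  · exact (h.std_lt _ ht b hb).le

/-- The basis stays reduced for two reasons: `t` exceeds all standard terms and all earlier leading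
exponents, hence divides none of them, and `hdiv` says that no earlier leading exponent divides `t`.
-/
lemma FGLMInvariant.addBasis (h : FGLMInvariant ord hc gc st std) (ht : (t, v) ∈ st.cand)
    (hmin : ∀ c ∈ st.cand, ord.toSyn t ≤ ord.toSyn c.1)
    (hrest : ∀ c, c ∈ rest ↔ c ∈ st.cand ∧ c.1 ≠ t)
    (hdiv : ¬ ∃ g ∈ st.gb, ord.degree g ≤ t)
    (hq : ∀ a ∉ std, coeff a q = coeff a (monomial t (1 : k))) (hqI : q ∈ triIdeal hc gc) :
    FGLMInvariant ord hc gc { st with cand := rest, gb := st.gb ++ [q] } std := by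
  obtain ⟨htstd, hct, hsupp, hdeg⟩ := coeff_reduced h ht hq
  have hlt : ∀ c ∈ rest, ord.toSyn t < ord.toSyn c.1 := fun c hcm =>
    lt_of_le_of_ne (hmin c ((hrest c).1 hcm).1)
      fun heq => ((hrest c).1 hcm).2 (ord.toSyn.injective heq).symm
  have hmem : ∀ g, g ∈ st.gb ++ [q] ↔ g ∈ st.gb ∨ g = q := by simp
  have hcand : ∀ c ∈ st.cand,
      FGLMReached ord { st with cand := rest, gb := st.gb ++ [q] } std c.1 := by
    intro c hcm
    by_cases hct : c.1 = t
    · exact Or.inr (Or.inr ⟨q, (hmem q).2 (Or.inr rfl), by rw [hct, hdeg]⟩)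
    · exact Or.inl ⟨c.2, (hrest c).2 ⟨hcm, hct⟩⟩
  have hgb : ∀ g ∈ st.gb, g ∈ st.gb ++ [q] := fun g hg => (hmem g).2 (Or.inl hg)
  exact
  { cand_nf := fun c hcm => h.cand_nf c ((hrest c).1 hcm).1
    std_lt := fun c hcm => h.std_lt c ((hrest c).1 hcm).1
    gb_lt := fun c hcm g hg => by
      rcases (hmem g).1 hg with hg | rfl
      · exact h.gb_lt c ((hrest c).1 hcm).1 g hg
      · rw [hdeg]; exact hlt c hcm
    ech := h.ech
    card_std := h.card_std
    indep := h.indep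
    gb_mem := fun g hg => by
      rcases (hmem g).1 hg with hg | rfl
      exacts [h.gb_mem g hg, hqI]
    gb_monic := fun g hg => by
      rcases (hmem g).1 hg with hg | rfl
      · exact h.gb_monic g hg
      · rw [MonomialOrder.leadingCoeff, hdeg, hct]
    gb_supp := fun g hg a ha => by
      rcases (hmem g).1 hg with hg | rfl
      · exact h.gb_supp g hg a ha
      · rw [hdeg]; exact hsupp a ha
    std_reduced := fun s hs g hg => by
      rcases (hmem g).1 hg with hg | rfl
      · exact h.std_reduced s hs g hg
      · rw [hdeg]
        exact fun hle => absurd (ord.toSyn_monotone hle) (not_le.2 (h.std_lt _ ht s hs))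
    gb_reduced := fun g hg g' hg' hne => by
      rcases (hmem g).1 hg with h1 | h1 <;> rcases (hmem g').1 hg' with h2 | h2
      · exact h.gb_reduced g h1 g' h2 hne
      · rw [h2, hdeg]
        exact fun hle => absurd (ord.toSyn_monotone hle) (not_le.2 (h.gb_lt _ ht g h1))
      · rw [h1, hdeg]
        exact fun hle => hdiv ⟨g', h2, hle⟩
      · exact absurd (h2.trans h1.symm) hne
    reached_zero := h.reached_zero.mono hcand (Finset.Subset.refl _) hgb
    reached_succ := fun s hs j => (h.reached_succ s hs j).mono hcand (Finset.Subset.refl _) hgb }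

/-- The delicate field is `indep`, a strengthened independence: a combination of standard terms
whose normal form vanishes at all pivots is zero. Subtracting a multiple of `q` removes `t` without
disturbing the old pivots, so the old invariant shows that the combination is a multiple of `q`; the
new pivot forces the multiple to be zero. -/
lemma FGLMInvariant.addStandard (h : FGLMInvariant ord hc gc st std) (ht : (t, v) ∈ st.cand)
    (hmin : ∀ c ∈ st.cand, ord.toSyn t ≤ ord.toSyn c.1)
    (hrest : ∀ c, c ∈ rest ↔ c ∈ st.cand ∧ c.1 ≠ t)
    (hdiv : ¬ ∃ g ∈ st.gb, ord.degree g ≤ t)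
    (hq : ∀ a ∉ std, coeff a q = coeff a (monomial t (1 : k))) (hqv : IsNF hc gc q v')
    (hv' : ∀ r ∈ st.ech, v' r.1 = 0) {p : Fin e} (hp : v' p ≠ 0)
    {new : Fin (N + 1) → Fin e → k}
    (hnew : ∀ j, IsNF hc gc (monomial (t + Finsupp.single j 1) 1) (new j)) :
    FGLMInvariant ord hc gc
      { cand := rest ++ List.ofFn fun j => (t + Finsupp.single j 1, new j)
        ech := st.ech ++ [(p, (v' p)⁻¹ • v', (v' p)⁻¹ • q)]
        gb := st.gb } (insert t std) := by
  classical
  obtain ⟨htstd, hct, hsupp, hdeg⟩ := coeff_reduced h ht hq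
  have hlt : ∀ c ∈ rest ++ List.ofFn fun j => (t + Finsupp.single j 1, new j),
      ord.toSyn t < ord.toSyn c.1 := by
    intro c hcm
    rcases List.mem_append.1 hcm with hcm | hcm
    · exact lt_of_le_of_ne (hmin c ((hrest c).1 hcm).1)
        fun heq => ((hrest c).1 hcm).2 (ord.toSyn.injective heq).symm
    · obtain ⟨j, rfl⟩ := List.mem_ofFn.1 hcm
      refine ord.toSyn_strictMono ?_
      exact lt_add_of_pos_right _ (pos_iff_ne_zero.2 (by simp))
  have hcand : ∀ c ∈ st.cand, FGLMReached ord
      { cand := rest ++ List.ofFn fun j => (t + Finsupp.single j 1, new j)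
        ech := st.ech ++ [(p, (v' p)⁻¹ • v', (v' p)⁻¹ • q)]
        gb := st.gb } (insert t std) c.1 := by
    intro c hcm
    by_cases hct : c.1 = t
    · exact Or.inr (Or.inl (by simp [hct]))
    · exact Or.inl ⟨c.2, List.mem_append_left _ ((hrest c).2 ⟨hcm, hct⟩)⟩
  exact
  { cand_nf := fun c hcm => by
      rcases List.mem_append.1 hcm with hcm | hcm
      · exact h.cand_nf c ((hrest c).1 hcm).1
      · obtain ⟨j, rfl⟩ := List.mem_ofFn.1 hcm
        exact hnew j
    std_lt := fun c hcm s hs => by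
      rcases Finset.mem_insert.1 hs with rfl | hs
      · exact hlt c hcm
      · exact (h.std_lt _ ht s hs).trans (hlt c hcm)
    gb_lt := fun c hcm g hg => (h.gb_lt _ ht g hg).trans (hlt c hcm)
    ech := by
      refine ⟨?_, ?_, ?_, ?_⟩
      · simp only [List.mem_append, List.mem_singleton]
        rintro r (hr | rfl)
        exacts [h.ech.nf r hr, hqv.smul _]
      · simp only [List.mem_append, List.mem_singleton]
        rintro r (hr | rfl)
        exacts [h.ech.pivot r hr, by simp [hp]]
      · refine List.pairwise_append.2 ⟨h.ech.pairwise, by simp, ?_⟩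
        intro r hr r' hr'
        rw [List.mem_singleton] at hr'
        simp [hr', hv' r hr]
      · simp only [List.mem_append, List.mem_singleton]
        rintro r (hr | rfl)
        · exact (h.ech.supp r hr).trans (Finset.subset_insert _ _)
        · intro a ha
          exact Finset.mem_insert.2 (hsupp a (support_smul ha))
    card_std := by simp [htstd, h.card_std]
    indep := fun f u hf hu hpiv => by
      have hzero : f - coeff t f • q = 0 := by
        refine h.indep _ (u - coeff t f • v') ?_ (hu.sub (hqv.smul _)) ?_
        · intro a ha
          have hat : a ≠ t := by
            rintro rfl
            simp [hct] at ha
          rcases Finset.mem_union.1 (support_sub _ _ _ ha) with h1 | h1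
          · exact (Finset.mem_insert.1 (hf h1)).resolve_left hat
          · exact (hsupp a (support_smul h1)).resolve_left hat
        · intro r hr
          simp [hv' r hr, hpiv r (List.mem_append_left _ hr)]
      have hfq : f = coeff t f • q := sub_eq_zero.1 hzero
      have hcoef : coeff t f = 0 := by
        have hnf : IsNF hc gc f (coeff t f • v') := by
          have := hqv.smul (coeff t f)
          rwa [← hfq] at this
        have h1 := hpiv (p, (v' p)⁻¹ • v', (v' p)⁻¹ • q) (by simp)
        rw [hu.unique hnf] at h1
        simpa [hp] using h1
      rw [hfq, hcoef, zero_smul]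
    gb_mem := h.gb_mem
    gb_monic := h.gb_monic
    gb_supp := fun g hg a ha => (h.gb_supp g hg a ha).imp_right fun hs =>
      Finset.mem_insert_of_mem hs
    std_reduced := fun s hs g hg => by
      rcases Finset.mem_insert.1 hs with rfl | hs
      · exact fun hle => hdiv ⟨g, hg, hle⟩
      · exact h.std_reduced s hs g hg
    gb_reduced := h.gb_reduced
    reached_zero := h.reached_zero.mono hcand (Finset.subset_insert _ _) fun _ => id
    reached_succ := fun s hs j => by
      rcases Finset.mem_insert.1 hs with rfl | hs
      · exact Or.inl ⟨new j, List.mem_append_right _ (List.mem_ofFn.2 ⟨j, rfl⟩)⟩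
      · exact (h.reached_succ s hs j).mono hcand (Finset.subset_insert _ _) fun _ => id }

end Step

open Classical in
-- With no candidates left, induction on the total degree shows that every term is standard or a
-- multiple of a leading term: divide by a variable and use `reached_succ`. An element of the ideal
-- without multiples of leading terms is then supported on `std`, so `indep` with normal form 0
-- makes it vanish.
lemma FGLMInvariant.isReducedGroebnerBasis {st : FGLMState k N e}
    {std : Finset (Fin (N + 1) →₀ ℕ)} (h : FGLMInvariant ord hc gc st std)
    (hcand : st.cand = []) :
    IsReducedGroebnerBasis ord st.gb.toFinset (triIdeal hc gc) := by
  have hall : ∀ (d : ℕ) (a : Fin (N + 1) →₀ ℕ), a.degree = d →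
      a ∈ std ∨ ∃ g ∈ st.gb, ord.degree g ≤ a := by
    intro d
    induction d with
    | zero =>
      intro a ha
      rw [Finsupp.degree_eq_zero_iff] at ha
      subst ha
      simpa [FGLMReached, hcand] using h.reached_zero
    | succ d ih =>
      intro a ha
      obtain ⟨j, hj⟩ : ∃ j, a j ≠ 0 := by
        by_contra! hcon
        have : a = 0 := Finsupp.ext hcon
        simp [this] at ha
      have hsplit : a = (a - Finsupp.single j 1) + Finsupp.single j 1 := by
        rw [tsub_add_cancel_of_le]
        rw [Finsupp.single_le_iff]
        omega
      have hdeg : (a - Finsupp.single j 1).degree = d := by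
        have := congrArg Finsupp.degree hsplit
        rw [ha, map_add, Finsupp.degree_single] at this
        omega
      rcases ih _ hdeg with hs | ⟨g, hg, hle⟩
      · rw [hsplit]
        simpa [FGLMReached, hcand] using h.reached_succ _ hs j
      · exact Or.inr ⟨g, hg, hle.trans tsub_le_self⟩
  refine isReducedGroebnerBasis_of_remainder_eq_zero ?_ ?_ ?_ ?_
  · simpa using h.gb_mem
  · simpa using h.gb_monic
  · simp only [List.mem_toFinset]
    intro g hg a ha g' hg' hne
    rcases h.gb_supp g hg a ha with rfl | hs
    · exact h.gb_reduced g hg g' hg' hne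
    · exact h.std_reduced a hs g' hg'
  · simp only [List.mem_toFinset]
    intro r hr hsupp
    have hrstd : r.support ⊆ std := fun a ha =>
      (hall _ a rfl).resolve_right fun ⟨g, hg, hle⟩ => hsupp a ha g hg hle
    exact h.indep r 0 hrstd (isNF_zero_iff.2 hr) (by simp)

end FGLMLoop

/-! ### Termination, correctness and cost of FGLM -/

section FGLMCorrect

variable {k : Type*} [Field k] {N e : ℕ} {hc : Fin e → k} {gc : Fin N → Fin e → k}
  {ord : MonomialOrder (Fin (N + 1))}

/-- The quantity bounded by `fuel` decreases in each pass: at least one candidate is removed, and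
the `N + 1` new ones of a standard term are paid for by the new echelon row. In the cost, the first
summand is reduction and pivot search in each pass. The second is charged once for each new row:
inversion, two scalings and `N + 1` linear combinations. -/
lemma fglmLoop_spec {tables : Fin (N + 1) → List (Fin e → k)}
    (htab : ∀ (j : Fin (N + 1)) (p : MvPolynomial (Fin (N + 1)) k) (v : Fin e → k),
      IsNF hc gc p v → IsNF hc gc (X j * p) (linComb (List.ofFn v) (tables j)).val)
    (fuel : ℕ) (st : FGLMState k N e) (std : Finset (Fin (N + 1) →₀ ℕ))
    (h : FGLMInvariant ord hc gc st std)
    (hfuel : st.cand.length + (N + 1) * (e - st.ech.length) ≤ fuel) :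
    (∃ st' std', FGLMInvariant ord hc gc st' std' ∧ st'.cand = [] ∧
      (fglmLoop ord tables fuel st).val = st'.gb) ∧
    (fglmLoop ord tables fuel st).cost ≤ fuel * (4 * e ^ 2 + e) +
      (e - st.ech.length) * (2 * e + 1 + (N + 1) * (2 * e ^ 2)) := by
  classical
  induction fuel generalizing st std with
  | zero =>
    have : st.cand = [] := List.eq_nil_of_length_eq_zero (by omega)
    exact ⟨⟨st, std, h, this, rfl⟩, by simp [fglmLoop]⟩
  | succ fuel ih =>
    cases harg : st.cand.argmin (fun c => ord.toSyn c.1) with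
    | none =>
      have hnil : st.cand = [] := List.argmin_eq_none.1 harg
      have hrun : fglmLoop ord tables (fuel + 1) st = pure st.gb := by
        simp only [fglmLoop, harg]
      rw [hrun]
      exact ⟨⟨st, std, h, hnil, rfl⟩, by simp⟩
    | some tv =>
      obtain ⟨t, v⟩ := tv
      have htm : (t, v) ∈ st.cand := List.argmin_mem harg
      have hmin : ∀ c ∈ st.cand, ord.toSyn t ≤ ord.toSyn c.1 := fun c hcm =>
        List.le_of_mem_argmin
          (f := fun c : (Fin (N + 1) →₀ ℕ) × (Fin e → k) => ord.toSyn c.1) hcm harg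
      have hrest : ∀ c, c ∈ st.cand.filter (fun c => c.1 ≠ t) ↔ c ∈ st.cand ∧ c.1 ≠ t := by
        intro c; simp
      have hlen : (st.cand.filter fun c => c.1 ≠ t).length + 1 ≤ st.cand.length := by
        refine List.length_filter_lt_length_iff_exists.2 ⟨(t, v), htm, by simp⟩
      by_cases hdiv : ∃ g ∈ st.gb, ord.degree g ≤ t
      · have hrun : fglmLoop ord tables (fuel + 1) st = fglmLoop ord tables fuel
            { st with cand := st.cand.filter fun c => c.1 ≠ t } := by
          simp only [fglmLoop, harg, if_pos hdiv]
        rw [hrun]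
        obtain ⟨i1, i2⟩ := ih { st with cand := st.cand.filter fun c => c.1 ≠ t } std
          (h.drop hrest hdiv) (by simp only; omega)
        refine ⟨i1, i2.trans ?_⟩
        simp only [add_mul]
        omega
      · set out := echReduce st.ech v (monomial t (1 : k)) with hout
        obtain ⟨o1, o2, o3, -⟩ := echReduce_spec h.ech (h.cand_nf _ htm)
        rw [← hout] at o1 o2 o3
        -- There are at most `e` rows, each with a vector of length `e` and a polynomial of at most
        -- `e` terms, at two operations per entry or term.
        have hech : out.cost ≤ 4 * e ^ 2 := by
          have hle := h.ech.length_le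
          have := echReduce_cost_le (D := e) st.ech (fun r hr =>
            (Finset.card_le_card (h.ech.supp r hr)).trans (h.card_std.trans_le hle)) v
            (monomial t (1 : k))
          refine this.trans ((Nat.mul_le_mul_right _ hle).trans (le_of_eq ?_))
          ring
        cases hpiv : (findPivot out.val.1).val with
        | none =>
          have hrun : fglmLoop ord tables (fuel + 1) st =
              ⟨(fglmLoop ord tables fuel { st with
                  cand := st.cand.filter fun c => c.1 ≠ t, gb := st.gb ++ [out.val.2] }).val,
                out.cost + (e + (fglmLoop ord tables fuel { st with
                  cand := st.cand.filter fun c => c.1 ≠ t, gb := st.gb ++ [out.val.2] }).cost)⟩ := by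
            simp only [fglmLoop, harg, if_neg hdiv]
            change Timed.mk _ _ = _
            simp only [val_bind, cost_bind, ← hout, hpiv, findPivot_cost]
          rw [hrun]
          have hz := findPivot_none hpiv
          rw [hz, isNF_zero_iff] at o1
          obtain ⟨i1, i2⟩ := ih { st with
              cand := st.cand.filter fun c => c.1 ≠ t, gb := st.gb ++ [out.val.2] } std
            (h.addBasis htm hmin hrest hdiv o3 o1) (by simp only; omega)
          refine ⟨i1, ?_⟩
          simp only [add_mul] at i2 ⊢
          omega
        | some pa =>
          obtain ⟨p, a⟩ := pa
          obtain ⟨rfl, hp⟩ := findPivot_some hpiv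
          set st' : FGLMState k N e :=
            { cand := (st.cand.filter fun c => c.1 ≠ t) ++ List.ofFn fun j =>
                (t + Finsupp.single j 1, (linComb (List.ofFn v) (tables j)).val)
              ech := st.ech ++
                [(p, (out.val.1 p)⁻¹ • out.val.1, (out.val.1 p)⁻¹ • out.val.2)]
              gb := st.gb } with hst'
          have hrun : fglmLoop ord tables (fuel + 1) st =
              ⟨(fglmLoop ord tables fuel st').val,
                out.cost + (e + (1 + (e + (out.val.2.support.card +
                  (∑ j, (linComb (List.ofFn v) (tables j)).cost +
                    (fglmLoop ord tables fuel st').cost)))))⟩ := by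
            simp only [fglmLoop, harg, if_neg hdiv]
            change Timed.mk _ _ = _
            simp only [val_bind, cost_bind, ← hout, hpiv, findPivot_cost, fieldInv, polyScale,
              val_charge, cost_charge, vecScale_val, vecScale_cost, val_all, cost_all, hst']
          have hinv : FGLMInvariant ord hc gc st' (insert t std) := by
            refine h.addStandard htm hmin hrest hdiv o3 o1 o2 hp fun j => ?_
            have := htab j _ _ (h.cand_nf _ htm)
            rwa [X, monomial_mul, one_mul, add_comm (Finsupp.single j 1)] at this
          have hlen' : st'.ech.length = st.ech.length + 1 := by simp [hst']
          have hcand' : st'.cand.length =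
              (st.cand.filter fun c => c.1 ≠ t).length + (N + 1) := by simp [hst']
          have hle : st.ech.length + 1 ≤ e := by rw [← hlen']; exact hinv.ech.length_le
          obtain ⟨r, hr⟩ : ∃ r, e = st.ech.length + 1 + r := ⟨_, (Nat.add_sub_cancel' hle).symm⟩
          have hr1 : e - st.ech.length = r + 1 := by omega
          have hr2 : e - st'.ech.length = r := by omega
          obtain ⟨i1, i2⟩ := ih st' _ hinv (by
            rw [hr2, hcand']
            rw [hr1, mul_add] at hfuel
            omega)
          rw [hrun]
          refine ⟨i1, ?_⟩
          obtain ⟨htstd, hct, hsupp, -⟩ := coeff_reduced h htm o3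
          -- The terms of the reduced polynomial lie in the enlarged set of standard terms, which
          -- has as many elements as the new echelon form has rows.
          have hq : out.val.2.support.card ≤ e := by
            refine (Finset.card_le_card (t := insert t std)
              fun a ha => Finset.mem_insert.2 (hsupp a ha)).trans ?_
            rw [hinv.card_std]
            exact hinv.ech.length_le
          have hlin : ∑ j, (linComb (List.ofFn v) (tables j)).cost ≤ (N + 1) * (2 * e ^ 2) := by
            refine (Finset.sum_le_sum fun j _ => linComb_cost_le _ _).trans (le_of_eq ?_)
            simp
            ring
          rw [hr2] at i2
          rw [hr1, Nat.succ_mul fuel, Nat.succ_mul r]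
          simp only
          omega

open Classical in
lemma fglm_isReducedGroebnerBasis (he : 0 < e) :
    IsReducedGroebnerBasis ord (fglm ord hc gc).val.toFinset (triIdeal hc gc) := by
  obtain ⟨⟨st, std, h1, h2, h3⟩, -⟩ := fglmLoop_spec (ord := ord) (hc := hc) (gc := gc)
    (fun j _ _ hv => isNF_linComb_multTables he j hv) (1 + (N + 1) * e) _ ∅
    (FGLMInvariant.initial he) (by simp)
  have : (fglm ord hc gc).val = st.gb := h3
  rw [this]
  exact h1.isReducedGroebnerBasis h2

lemma fglm_cost_le (he : 0 < e) : (fglm ord hc gc).cost ≤ 21 * ((N + 1) * e ^ 3) := by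
  obtain ⟨-, h⟩ := fglmLoop_spec (ord := ord) (hc := hc) (gc := gc)
    (fun j _ _ hv => isNF_linComb_multTables he j hv) (1 + (N + 1) * e) _ ∅
    (FGLMInvariant.initial he) (by simp)
  have h0 : (fglm ord hc gc).cost = (multTables hc gc).cost +
    (fglmLoop ord (multTables hc gc).val (1 + (N + 1) * e)
      { cand := [(0, oneVec)], ech := [], gb := [] }).cost := rfl
  rw [h0]
  have h1 := multTables_cost_le (hc := hc) (gc := gc)
  simp only [List.length_nil, Nat.sub_zero] at h
  refine (Nat.add_le_add h1 h).trans ?_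
  -- As `e ≥ 1`, lower powers of `e` are absorbed into `e ^ 3`; the substitution turns this into an
  -- inequality between polynomials in `N` and `r`.
  obtain ⟨r, rfl⟩ : ∃ r, e = r + 1 := ⟨e - 1, by omega⟩
  ring_nf
  nlinarith [Nat.zero_le (N * r), Nat.zero_le (N * r ^ 2), Nat.zero_le (N * r ^ 3),
    Nat.zero_le (r ^ 2), Nat.zero_le (r ^ 3)]

end FGLMCorrect

/-! ### The backward transformation: ideal, degrees and cost -/

section Transform

variable {k : Type*} [Field k] {n : ℕ}

lemma polyDot_val (M : ℕ → ℕ → ℕ) (l : List (MvPolynomial (Fin n) k × MvPolynomial (Fin n) k)) :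
    (polyDot M l).val = (l.map fun p => p.1 * p.2).sum := by
  induction l with
  | nil => rfl
  | cons p l ih => simp [polyDot, polyMul, polyAdd, ih]

lemma polyMulVec_val (M : ℕ → ℕ → ℕ) {a b : ℕ}
    (A : Matrix (Fin a) (Fin b) (MvPolynomial (Fin n) k)) (v : Fin b → MvPolynomial (Fin n) k) :
    (polyMulVec M A v).val = A.mulVec v := by
  ext1 i
  simp [polyMulVec, polyDot_val, List.map_ofFn, List.sum_ofFn, Matrix.mulVec, dotProduct]

/-- An addition costs at most as much as a multiplication, since `M` dominates the number of
coefficients; hence the factor 2. -/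
lemma polyDot_bounds {M : ℕ → ℕ → ℕ} (hM : Monotone (M n))
    (hM' : ∀ D, (n + D).choose n ≤ M n D) {D₁ D₂ : ℕ}
    (l : List (MvPolynomial (Fin n) k × MvPolynomial (Fin n) k))
    (hl : ∀ p ∈ l, p.1.totalDegree ≤ D₁ ∧ p.2.totalDegree ≤ D₂) :
    (polyDot M l).val.totalDegree ≤ D₁ + D₂ ∧
      (polyDot M l).cost ≤ l.length * (2 * M n (D₁ + D₂)) := by
  induction l with
  | nil => simp [polyDot]
  | cons p l ih =>
    obtain ⟨a, b⟩ := p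
    simp only [List.mem_cons, forall_eq_or_imp] at hl
    obtain ⟨i1, i2⟩ := ih hl.2
    have hab : (a * b).totalDegree ≤ D₁ + D₂ :=
      (totalDegree_mul a b).trans (Nat.add_le_add hl.1.1 hl.1.2)
    constructor
    · simp only [polyDot, polyMul, polyAdd, val_bind, val_charge]
      exact (totalDegree_add _ _).trans (max_le hab i1)
    · simp only [polyDot, polyMul, polyAdd, cost_bind, val_charge, cost_charge, List.length_cons]
      have h1 : M n (max a.totalDegree b.totalDegree) ≤ M n (D₁ + D₂) :=
        hM (max_le (hl.1.1.trans (Nat.le_add_right _ _)) (hl.1.2.trans (Nat.le_add_left _ _)))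
      have h2 : (n + max (a * b).totalDegree (polyDot M l).val.totalDegree).choose n ≤
          M n (D₁ + D₂) := (hM' _).trans (hM (max_le hab i1))
      rw [Nat.succ_mul]
      omega

lemma polyMulVec_bounds {M : ℕ → ℕ → ℕ} (hM : Monotone (M n))
    (hM' : ∀ D, (n + D).choose n ≤ M n D) {D₁ D₂ a b : ℕ}
    {A : Matrix (Fin a) (Fin b) (MvPolynomial (Fin n) k)} {v : Fin b → MvPolynomial (Fin n) k}
    (hA : ∀ i j, (A i j).totalDegree ≤ D₁) (hv : ∀ j, (v j).totalDegree ≤ D₂) :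
    (∀ i, ((polyMulVec M A v).val i).totalDegree ≤ D₁ + D₂) ∧
      (polyMulVec M A v).cost ≤ a * b * (2 * M n (D₁ + D₂)) := by
  have key : ∀ i, ∀ p ∈ List.ofFn fun j => (A i j, v j),
      p.1.totalDegree ≤ D₁ ∧ p.2.totalDegree ≤ D₂ := by
    intro i p hp
    obtain ⟨j, rfl⟩ := List.mem_ofFn.1 hp
    exact ⟨hA i j, hv j⟩
  refine ⟨fun i => (polyDot_bounds hM hM' _ (key i)).1, ?_⟩
  simp only [polyMulVec, cost_all]
  refine (Finset.sum_le_sum fun i _ => (polyDot_bounds hM hM' _ (key i)).2).trans (le_of_eq ?_)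
  simp [mul_assoc]

lemma totalDegree_polyOfCoeffs_le {D : ℕ} (c : Expo n D → k) :
    (polyOfCoeffs c).totalDegree ≤ D := by
  refine totalDegree_finsetSum_le fun a _ => (totalDegree_monomial_le _ _).trans ?_
  rw [Finsupp.sum_fintype _ _ (fun _ => rfl)]
  exact a.2

lemma totalDegree_unitUpper_le {D s : ℕ} {c : Above s → MvPolynomial (Fin n) k}
    (hc : ∀ p, (c p).totalDegree ≤ D) (i j : Fin s) : (unitUpper c i j).totalDegree ≤ D := by
  unfold unitUpper
  split_ifs
  · exact hc _
  · simp
  · simp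

section Span

variable {R : Type*} [CommRing R]

lemma det_unitUpper {s : ℕ} (c : Above s → R) : (unitUpper c).det = 1 := by
  rw [Matrix.det_of_isUpperTriangular]
  · simp [unitUpper]
  · intro i j hij
    have h1 : ¬ i < j := not_lt.2 (le_of_lt hij)
    have h2 : i ≠ j := (ne_of_lt hij).symm
    simp [unitUpper, h1, h2]

lemma span_range_mulVec_le {ι κ : Type*} [Fintype κ] (A : Matrix ι κ R) (v : κ → R) :
    Ideal.span (Set.range (A.mulVec v)) ≤ Ideal.span (Set.range v) := by
  refine Ideal.span_le.2 ?_
  rintro _ ⟨i, rfl⟩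
  exact Ideal.sum_mem _ fun j _ => Ideal.mul_mem_left _ _ (Ideal.subset_span ⟨j, rfl⟩)

/-- A matrix of determinant one is invertible over the ring, and applying the inverse gives the
other inclusion. -/
lemma span_range_unitUpper_mulVec {s : ℕ} (c : Above s → R) (v : Fin s → R) :
    Ideal.span (Set.range ((unitUpper c).mulVec v)) = Ideal.span (Set.range v) := by
  refine le_antisymm (span_range_mulVec_le _ _) ?_
  have h := span_range_mulVec_le (unitUpper c)⁻¹ ((unitUpper c).mulVec v)
  rwa [Matrix.mulVec_mulVec, Matrix.nonsing_inv_mul _ (by rw [det_unitUpper]; exact isUnit_one),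
    Matrix.one_mulVec] at h

/-- Append zeros to a vector. -/
def padZero {n : ℕ} (s : ℕ) (w : Fin n → R) : Fin s → R :=
  fun i => if h : (i : ℕ) < n then w ⟨i, h⟩ else 0

lemma span_range_padZero {n s : ℕ} (hns : n ≤ s) (w : Fin n → R) :
    Ideal.span (Set.range (padZero s w)) = Ideal.span (Set.range w) := by
  refine le_antisymm (Ideal.span_le.2 ?_) (Ideal.span_mono ?_)
  · rintro _ ⟨i, rfl⟩
    simp only [padZero]
    split_ifs with h
    · exact Ideal.subset_span ⟨_, rfl⟩
    · exact Ideal.zero_mem _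
  · rintro _ ⟨i, rfl⟩
    exact ⟨⟨i, i.2.trans_le hns⟩, by simp [padZero]⟩

end Span

namespace Draw

variable {N d d' smax : ℕ} (ω : Draw k N d d' smax)

/-- The vector `U₂' G`. -/
def inner : Fin (N + 1) → MvPolynomial (Fin (N + 1)) k :=
  ω.U₂'.mulVec (triBasis ω.hCoeff ω.gCoeff)

/-- The vector `P U₂ G`. -/
def middle : Fin ω.shape.size → MvPolynomial (Fin (N + 1)) k :=
  fun i => padZero ω.shape.size ω.inner (ω.shape.perm i)

/-- The vector `U₁ P U₂ G`. -/
def output : Fin ω.shape.size → MvPolynomial (Fin (N + 1)) k := ω.U₁.mulVec ω.middle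

lemma sampleBasis_val (S : ℕ → ℕ → ℕ) : (sampleBasis S ω).val = triBasis ω.hCoeff ω.gCoeff := rfl

lemma backwardTransform_val (S M : ℕ → ℕ → ℕ) :
    (backwardTransform S M ω (triBasis ω.hCoeff ω.gCoeff)).val = ω.output := by
  simp only [backwardTransform, val_bind, val_charge, polyMulVec_val]
  rfl

lemma span_range_output :
    Ideal.span (Set.range ω.output) = triIdeal ω.hCoeff ω.gCoeff := by
  rw [output, U₁, span_range_unitUpper_mulVec]
  have h : Set.range ω.middle = Set.range (padZero ω.shape.size ω.inner) :=
    ω.shape.perm.surjective.range_comp _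
  rw [h, span_range_padZero ω.shape.le_size, inner, U₂', span_range_unitUpper_mulVec]
  rfl

open Classical in
lemma span_image_output :
    Ideal.span ((Finset.univ.image ω.output : Finset (MvPolynomial (Fin (N + 1)) k)) :
      Set (MvPolynomial (Fin (N + 1)) k)) = triIdeal ω.hCoeff ω.gCoeff := by
  rw [Finset.coe_image, Finset.coe_univ, Set.image_univ, span_range_output]

lemma totalDegree_lastEmb_le {e : ℕ} (v : Fin e → k) :
    (lastEmb v : MvPolynomial (Fin (N + 1)) k).totalDegree ≤ e := by
  rw [lastEmb_eq_sum_monomial]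
  refine totalDegree_finsetSum_le fun a _ => (totalDegree_monomial_le _ _).trans ?_
  rw [Finsupp.sum_single_index rfl]
  exact a.2.le

lemma totalDegree_triBasis_le {e : ℕ} (he : 0 < e) (hc : Fin e → k) (gc : Fin N → Fin e → k)
    (i : Fin (N + 1)) : (triBasis hc gc i).totalDegree ≤ e := by
  refine Fin.cases ?_ (fun j => ?_) i
  · simp only [triBasis, Fin.cons_zero]
    refine (totalDegree_add _ _).trans (max_le ?_ (totalDegree_lastEmb_le _))
    rw [totalDegree_X_pow]
  · simp only [triBasis, Fin.cons_succ]
    refine (totalDegree_sub _ _).trans (max_le ?_ (totalDegree_lastEmb_le _))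
    rw [totalDegree_X]
    exact he

lemma card_above_le (s : ℕ) : Fintype.card (Above s) ≤ s ^ 2 := by
  refine (Fintype.card_subtype_le _).trans ?_
  simp [sq]

lemma sampleBasis_cost_le {S : ℕ → ℕ → ℕ} (hS : Monotone (S 1))
    (hS' : ∀ D, (1 + D).choose 1 ≤ S 1 D) :
    (sampleBasis S ω).cost ≤ 2 * ((N + 1) * S 1 d) := by
  have h0 : (sampleBasis S ω).cost = S 1 d + (N * S 1 (ω.shape.deg - 1) + N * ω.shape.deg) := by
    simp [sampleBasis]
  have h1 : S 1 (ω.shape.deg - 1) ≤ S 1 d := hS (by have := ω.shape.deg_le; omega)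
  have h2 : ω.shape.deg ≤ S 1 d := by
    have := hS' d
    have := ω.shape.deg_le
    simp at *
    omega
  rw [h0]
  nlinarith [Nat.mul_le_mul_left N h1, Nat.mul_le_mul_left N h2]

lemma backwardTransform_cost_le {S M : ℕ → ℕ → ℕ} (hM : Monotone (M (N + 1)))
    (hS' : ∀ D, (N + 1 + D).choose (N + 1) ≤ S (N + 1) D)
    (hM' : ∀ D, (N + 1 + D).choose (N + 1) ≤ M (N + 1) D) :
    (backwardTransform S M ω (triBasis ω.hCoeff ω.gCoeff)).cost ≤
      4 * (ω.shape.size ^ 2 * S (N + 1) d' +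
        ((N + 1) ^ 2 + ω.shape.size ^ 2) * M (N + 1) (2 * d' + d)) := by
  have hU₁ : ∀ i j, (ω.U₁ i j).totalDegree ≤ d' :=
    totalDegree_unitUpper_le fun p => totalDegree_polyOfCoeffs_le _
  have hU₂ : ∀ i j, (ω.U₂' i j).totalDegree ≤ d' :=
    totalDegree_unitUpper_le fun p => totalDegree_polyOfCoeffs_le _
  have hG : ∀ i, (triBasis ω.hCoeff ω.gCoeff i).totalDegree ≤ d := fun i =>
    (totalDegree_triBasis_le ω.shape.deg_pos _ _ i).trans ω.shape.deg_le
  obtain ⟨b1, b2⟩ := polyMulVec_bounds hM hM' hU₂ hG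
  have hmid : ∀ i, (ω.middle i).totalDegree ≤ d' + d := by
    intro i
    rw [polyMulVec_val] at b1
    simp only [middle, padZero]
    split_ifs
    · exact b1 _
    · simp
  obtain ⟨-, b3⟩ := polyMulVec_bounds hM hM' hU₁ hmid
  have h0 : (backwardTransform S M ω (triBasis ω.hCoeff ω.gCoeff)).cost =
      (1 + Fintype.card (Above ω.shape.size) * S (N + 1) d') +
        (Fintype.card (Above (N + 1)) * S (N + 1) d' +
          ((polyMulVec M ω.U₂' (triBasis ω.hCoeff ω.gCoeff)).cost +
            (ω.shape.size + (polyMulVec M ω.U₁ ω.middle).cost))) := by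
    simp only [backwardTransform, cost_bind, cost_charge, val_charge, polyMulVec_val,
      Finset.sum_const, Finset.card_univ, smul_eq_mul]
    rfl
  have hs : N + 1 ≤ ω.shape.size := ω.shape.le_size
  have c1 := Nat.mul_le_mul_right (S (N + 1) d') (card_above_le ω.shape.size)
  have c2 := Nat.mul_le_mul_right (S (N + 1) d') ((card_above_le (N + 1)).trans
    (Nat.pow_le_pow_left hs 2))
  -- The costs of sampling the size and the permutation, `1` and `s`, are absorbed into `s ^ 2 * S
  -- (N + 1) d'`.
  have hpos : 1 ≤ S (N + 1) d' := (Nat.choose_pos (Nat.le_add_right _ _)).trans_le (hS' d')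
  have c3 : ω.shape.size ≤ ω.shape.size ^ 2 * S (N + 1) d' := by
    calc ω.shape.size ≤ ω.shape.size ^ 2 := Nat.le_self_pow two_ne_zero _
      _ ≤ _ := Nat.le_mul_of_pos_right _ hpos
  -- The product with `U₂'` has degree at most `d' + d`, and the one with `U₁` at most `2 * d' + d`.
  have c4 : M (N + 1) (d' + d) ≤ M (N + 1) (2 * d' + d) := hM (by omega)
  have c5 : d' + (d' + d) = 2 * d' + d := by ring
  rw [c5] at b3
  have c6 := Nat.mul_le_mul_left ((N + 1) * (N + 1)) (Nat.mul_le_mul_left 2 c4)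
  rw [h0]
  nlinarith

open Classical in
lemma generatePair_val_lex (S M : ℕ → ℕ → ℕ) {ord : MonomialOrder (Fin (N + 1))} (h : IsLex ord) :
    (generatePair S M ord ω).val =
      (Finset.univ.image ω.output, Finset.univ.image (triBasis ω.hCoeff ω.gCoeff)) := by
  simp only [generatePair, val_bind, sampleBasis_val, backwardTransform_val, if_pos h, val_pure]

open Classical in
lemma generatePair_val_not_lex (S M : ℕ → ℕ → ℕ) {ord : MonomialOrder (Fin (N + 1))}
    (h : ¬ IsLex ord) :
    (generatePair S M ord ω).val =
      (Finset.univ.image ω.output, (fglm ord ω.hCoeff ω.gCoeff).val.toFinset) := by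
  simp only [generatePair, val_bind, sampleBasis_val, backwardTransform_val, if_neg h, val_pure]

lemma generatePair_cost_lex (S M : ℕ → ℕ → ℕ) {ord : MonomialOrder (Fin (N + 1))}
    (h : IsLex ord) :
    (generatePair S M ord ω).cost = (sampleBasis S ω).cost +
      (backwardTransform S M ω (triBasis ω.hCoeff ω.gCoeff)).cost := by
  simp only [generatePair, cost_bind, sampleBasis_val, if_pos h, cost_pure, add_zero]

lemma generatePair_cost_not_lex (S M : ℕ → ℕ → ℕ) {ord : MonomialOrder (Fin (N + 1))}
    (h : ¬ IsLex ord) :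
    (generatePair S M ord ω).cost = (sampleBasis S ω).cost +
      ((backwardTransform S M ω (triBasis ω.hCoeff ω.gCoeff)).cost +
        (fglm ord ω.hCoeff ω.gCoeff).cost) := by
  simp only [generatePair, cost_bind, sampleBasis_val, if_neg h, cost_pure, add_zero]

end Draw

end Transform

/-! ### Polynomial dependence on the sample and Schwartz–Zippel -/

section PolynomialFunctions

variable {k : Type*} [Field k] {ι σ : Type*}

/-- The function `φ` is given by a polynomial of total degree at most `D`. -/
def IsPolyFun (D : ℕ) (φ : (ι → k) → k) : Prop :=
  ∃ p : MvPolynomial ι k, p.totalDegree ≤ D ∧ ∀ c, eval c p = φ c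

lemma isPolyFun_const (D : ℕ) (a : k) : IsPolyFun D fun _ : ι → k => a :=
  ⟨C a, by simp, by simp⟩

lemma isPolyFun_coord {D : ℕ} (hD : 1 ≤ D) (i : ι) : IsPolyFun D fun c : ι → k => c i :=
  ⟨X i, by simpa using hD, by simp⟩

lemma IsPolyFun.add {D : ℕ} {φ ψ : (ι → k) → k} (hφ : IsPolyFun D φ) (hψ : IsPolyFun D ψ) :
    IsPolyFun D fun c => φ c + ψ c := by
  obtain ⟨p, hp, hp'⟩ := hφ
  obtain ⟨q, hq, hq'⟩ := hψ
  exact ⟨p + q, (totalDegree_add p q).trans (max_le hp hq), fun c => by simp [hp', hq']⟩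

lemma IsPolyFun.mul {D D' : ℕ} {φ ψ : (ι → k) → k} (hφ : IsPolyFun D φ) (hψ : IsPolyFun D' ψ) :
    IsPolyFun (D + D') fun c => φ c * ψ c := by
  obtain ⟨p, hp, hp'⟩ := hφ
  obtain ⟨q, hq, hq'⟩ := hψ
  exact ⟨p * q, (totalDegree_mul p q).trans (Nat.add_le_add hp hq), fun c => by simp [hp', hq']⟩

lemma IsPolyFun.sum {D : ℕ} {α : Type*} (s : Finset α) {φ : α → (ι → k) → k}
    (h : ∀ a ∈ s, IsPolyFun D (φ a)) : IsPolyFun D fun c => ∑ a ∈ s, φ a c := by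
  classical
  induction s using Finset.induction_on with
  | empty => simpa using isPolyFun_const D 0
  | insert a s ha ih =>
    simp only [Finset.sum_insert ha]
    exact (h a (Finset.mem_insert_self a s)).add
      (ih fun b hb => h b (Finset.mem_insert_of_mem hb))

/-- All coefficients of the polynomial `f c` are given by polynomials in `c` of total degree at
most `D`. -/
def IsPolyFamily (D : ℕ) (f : (ι → k) → MvPolynomial σ k) : Prop :=
  ∀ m, IsPolyFun D fun c => coeff m (f c)

lemma isPolyFamily_const (D : ℕ) (p : MvPolynomial σ k) :
    IsPolyFamily D fun _ : ι → k => p := fun _ => isPolyFun_const D _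

lemma isPolyFamily_monomial {D : ℕ} (m : σ →₀ ℕ) {φ : (ι → k) → k} (h : IsPolyFun D φ) :
    IsPolyFamily D fun c => monomial m (φ c) := by
  classical
  intro m'
  simp only [coeff_monomial]
  split_ifs
  exacts [h, isPolyFun_const D 0]

lemma IsPolyFamily.add {D : ℕ} {f g : (ι → k) → MvPolynomial σ k} (hf : IsPolyFamily D f)
    (hg : IsPolyFamily D g) : IsPolyFamily D fun c => f c + g c := fun m => by
  simpa only [coeff_add] using (hf m).add (hg m)

lemma IsPolyFamily.mul {D D' : ℕ} {f g : (ι → k) → MvPolynomial σ k} (hf : IsPolyFamily D f)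
    (hg : IsPolyFamily D' g) : IsPolyFamily (D + D') fun c => f c * g c := fun m => by
  classical
  simp only [coeff_mul]
  exact IsPolyFun.sum _ fun a _ => (hf a.1).mul (hg a.2)

lemma IsPolyFamily.sum {D : ℕ} {α : Type*} (s : Finset α) {f : α → (ι → k) → MvPolynomial σ k}
    (h : ∀ a ∈ s, IsPolyFamily D (f a)) : IsPolyFamily D fun c => ∑ a ∈ s, f a c := fun m => by
  simp only [coeff_sum]
  exact IsPolyFun.sum s fun a ha => h a ha m

lemma IsPolyFamily.sub {D : ℕ} {f g : (ι → k) → MvPolynomial σ k} (hf : IsPolyFamily D f)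
    (hg : IsPolyFamily D g) : IsPolyFamily D fun c => f c - g c := by
  have h : IsPolyFamily D fun c => C (-1) * g c := by
    simpa using (isPolyFamily_const (ι := ι) 0 (C (-1) : MvPolynomial σ k)).mul hg
  simpa [sub_eq_add_neg] using hf.add h

lemma IsPolyFamily.mulVec {D D' : ℕ} {α β : Type*} [Fintype β]
    {A : (ι → k) → Matrix α β (MvPolynomial σ k)} {v : (ι → k) → β → MvPolynomial σ k}
    (hA : ∀ i j, IsPolyFamily D fun c => A c i j) (hv : ∀ j, IsPolyFamily D' fun c => v c j)
    (i : α) : IsPolyFamily (D + D') fun c => (A c).mulVec (v c) i :=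
  IsPolyFamily.sum _ fun j _ => (hA i j).mul (hv j)

/-- Finitely many nonzero polynomial functions of bounded degree vanish only on the zeros of one
nonzero polynomial. -/
lemma exists_polynomial_of_isPolyFun {s D : ℕ} {φ : Fin s → (ι → k) → k}
    (h : ∀ i, IsPolyFun D (φ i)) (hne : ∀ i, ∃ c, φ i c ≠ 0) :
    ∃ Q : MvPolynomial ι k, Q ≠ 0 ∧ Q.totalDegree ≤ D * s ∧
      ∀ c, (∃ i, φ i c = 0) → eval c Q = 0 := by
  choose p hp hp' using h
  refine ⟨∏ i, p i, ?_, ?_, ?_⟩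
  · refine Finset.prod_ne_zero_iff.2 fun i _ h0 => ?_
    obtain ⟨c, hc⟩ := hne i
    rw [← hp' i c, h0, map_zero] at hc
    exact hc rfl
  · refine (totalDegree_finsetProd _ _).trans ((Finset.sum_le_sum fun i _ => hp i).trans ?_)
    simp [mul_comm]
  · rintro c ⟨i, hi⟩
    rw [map_prod]
    exact Finset.prod_eq_zero (Finset.mem_univ i) (by rw [hp', hi])

lemma zeroProportion_le [Fintype ι] {Q : MvPolynomial ι k} (hQ : Q ≠ 0) (B : Finset k) :
    zeroProportion Q B ≤ (Q.totalDegree : ℚ) / B.card := by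
  classical
  -- The Schwartz–Zippel bound is for variables indexed by `Fin`, so variables and points are
  -- reindexed.
  let σ := Fintype.equivFin ι
  have hQ' : rename σ Q ≠ 0 := fun h => hQ (rename_injective _ σ.injective (by simpa using h))
  have h := schwartz_zippel_totalDegree hQ' B
  rw [show (rename σ Q).totalDegree = Q.totalDegree from totalDegree_renameEquiv σ Q] at h
  have h1 : Nat.card {c : ι → B // eval (fun i => (c i : k)) Q = 0} =
      (Finset.filter (fun f => eval f (rename σ Q) = 0)
        (Fintype.piFinset fun _ : Fin (Fintype.card ι) => B)).card := by
    rw [← Nat.card_eq_finsetCard]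
    refine Nat.card_congr
      { toFun := fun c => ⟨fun i => (c.1 (σ.symm i) : k), ?_⟩
        invFun := fun f => ⟨fun i => ⟨f.1 (σ i), ?_⟩, ?_⟩
        left_inv := fun c => by ext i; simp
        right_inv := fun f => by ext i; simp }
    · rw [Finset.mem_filter, Fintype.mem_piFinset, eval_rename]
      refine ⟨fun i => (c.1 _).2, ?_⟩
      simpa [Function.comp_def] using c.2
    · exact Fintype.mem_piFinset.1 (Finset.mem_filter.1 f.2).1 _
    · have := (Finset.mem_filter.1 f.2).2
      rwa [eval_rename] at this
  have h2 : Nat.card (ι → B) = B.card ^ Fintype.card ι := by simp [Nat.card_eq_fintype_card]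
  rw [zeroProportion, h1, h2]
  push_cast
  exact_mod_cast h

end PolynomialFunctions

/-! ### Realizing prescribed matrices by samples -/

section Sampling

variable {k : Type*} [Field k] {n : ℕ}

/-- The exponent vector of an element of `Expo`. -/
def Expo.toFinsupp {D : ℕ} (a : Expo n D) : Fin n →₀ ℕ :=
  Finsupp.equivFunOnFinite.symm fun i => (a.1 i : ℕ)

lemma Expo.toFinsupp_injective {D : ℕ} : Function.Injective (Expo.toFinsupp (n := n) (D := D)) := by
  intro a b h
  ext i
  exact DFunLike.congr_fun h i

lemma polyOfCoeffs_eq {D : ℕ} (c : Expo n D → k) :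
    polyOfCoeffs c = ∑ a, monomial a.toFinsupp (c a) := rfl

lemma coeff_polyOfCoeffs {D : ℕ} (c : Expo n D → k) (a : Expo n D) :
    coeff a.toFinsupp (polyOfCoeffs c) = c a := by
  classical
  rw [polyOfCoeffs_eq, coeff_sum, Finset.sum_eq_single a]
  · simp
  · intro b _ hb
    rw [coeff_monomial, if_neg fun h => hb (Expo.toFinsupp_injective h)]
  · simp

/-- The exponent vector of a variable. -/
def Expo.single {D : ℕ} (hD : 0 < D) (i : Fin n) : Expo n D :=
  ⟨fun j => if j = i then ⟨1, by omega⟩ else ⟨0, by omega⟩, by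
    have h : ∀ j, ((if j = i then ⟨1, by omega⟩ else ⟨0, by omega⟩ : Fin (D + 1)) : ℕ) =
        if j = i then 1 else 0 := fun j => by split_ifs <;> rfl
    simp only [h, Finset.sum_ite_eq', Finset.mem_univ, if_true]
    exact hD⟩

lemma Expo.toFinsupp_single {D : ℕ} (hD : 0 < D) (i : Fin n) :
    (Expo.single hD i).toFinsupp = Finsupp.single i 1 := by
  ext j
  simp only [Expo.toFinsupp, Expo.single, Finsupp.equivFunOnFinite_symm_apply_apply,
    Finsupp.single_apply, eq_comm (a := i)]
  split_ifs <;> rfl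

/-- The zero exponent vector. -/
def Expo.zero (n D : ℕ) : Expo n D := ⟨fun _ => 0, by simp⟩

lemma exists_polyOfCoeffs_monomial {D : ℕ} (a : Expo n D) :
    ∃ c : Expo n D → k, polyOfCoeffs c = monomial a.toFinsupp 1 := by
  classical
  refine ⟨Pi.single a 1, ?_⟩
  rw [polyOfCoeffs_eq, Finset.sum_eq_single a]
  · simp
  · intro b _ hb
    simp [hb]
  · simp

lemma exists_polyOfCoeffs_zero (D : ℕ) : ∃ c : Expo n D → k, polyOfCoeffs c = 0 :=
  ⟨0, by simp [polyOfCoeffs_eq]⟩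

lemma exists_polyOfCoeffs_one (D : ℕ) : ∃ c : Expo n D → k, polyOfCoeffs c = 1 := by
  obtain ⟨c, hc⟩ := exists_polyOfCoeffs_monomial (k := k) (Expo.zero n D)
  refine ⟨c, hc.trans ?_⟩
  have : (Expo.zero n D).toFinsupp = 0 := by ext; simp [Expo.toFinsupp, Expo.zero]
  rw [this]
  rfl

lemma exists_polyOfCoeffs_X {D : ℕ} (hD : 0 < D) (i : Fin n) :
    ∃ c : Expo n D → k, polyOfCoeffs c = X i := by
  obtain ⟨c, hc⟩ := exists_polyOfCoeffs_monomial (k := k) (Expo.single hD i)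
  exact ⟨c, by rw [hc, Expo.toFinsupp_single]; rfl⟩

section UnitUpper

variable {R : Type*} [CommRing R] {s : ℕ}

/-- The matrix that adds `z` times row `j` to row `i`. -/
def elementary (i j : Fin s) (z : R) : Above s → R := fun p => if p.1 = (i, j) then z else 0

lemma unitUpper_zero : unitUpper (0 : Above s → R) = 1 := by
  ext i j
  simp only [unitUpper, Matrix.one_apply, Pi.zero_apply]
  split_ifs with h1 h2 <;> first | rfl | exact absurd h2 h1.ne

lemma unitUpper_elementary_mulVec {i j : Fin s} (hij : i < j) (z : R) (v : Fin s → R)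
    (l : Fin s) : (unitUpper (elementary i j z)).mulVec v l = v l + if l = i then z * v j else 0 := by
  classical
  have h : ∀ m, unitUpper (elementary i j z) l m =
      (if l = m then 1 else 0) + if l = i ∧ m = j then z else 0 := by
    intro m
    simp only [unitUpper, elementary, Prod.mk.injEq]
    split_ifs with h1 h2 h3 <;> simp_all
    exact absurd (h2.1.symm.trans h2.2) hij.ne
  simp only [Matrix.mulVec, dotProduct, h, add_mul, Finset.sum_add_distrib, ite_mul, one_mul,
    zero_mul, Finset.sum_ite_eq, Finset.mem_univ, if_true]
  congr 1
  by_cases hl : l = i <;> simp [hl]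

lemma unitUpper_mulVec_last (c : Above (s + 1) → R) (v : Fin (s + 1) → R) :
    (unitUpper c).mulVec v (Fin.last s) = v (Fin.last s) := by
  simp only [Matrix.mulVec, dotProduct]
  rw [Finset.sum_eq_single (Fin.last s)]
  · simp [unitUpper]
  · intro j _ hj
    have h1 : ¬ Fin.last s < j := not_lt.2 (Fin.le_last j)
    simp [unitUpper, h1, hj.symm]
  · simp

/-- Rows below the last nonzero entry of `v` give zero, and the row of that entry gives it. -/
lemma unitUpper_mulVec_of_zero {c : Above s → R} {v : Fin s → R} {l : Fin s}
    (hv : ∀ j, l < j → v j = 0) (i : Fin s) (hi : l ≤ i) :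
    (unitUpper c).mulVec v i = v i := by
  simp only [Matrix.mulVec, dotProduct]
  rw [Finset.sum_eq_single i]
  · simp [unitUpper]
  · intro j _ hj
    by_cases h1 : i < j
    · rw [hv j (hi.trans_lt h1), mul_zero]
    · simp [unitUpper, h1, hj.symm]
  · simp

end UnitUpper

variable {N d d' smax : ℕ}

/-- Nonvanishing of a coefficient need only be shown for one sample; this allows that sample to be
described by its matrices instead of its coordinates. -/
lemma exists_output_eq (sh : Shape N d smax) (hc : Fin sh.deg → k) (gc : Fin N → Fin sh.deg → k)
    {w₁ : Above sh.size → MvPolynomial (Fin (N + 1)) k}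
    {w₂ : Above (N + 1) → MvPolynomial (Fin (N + 1)) k}
    (h₁ : ∀ p, ∃ c : Expo (N + 1) d' → k, polyOfCoeffs c = w₁ p)
    (h₂ : ∀ p, ∃ c : Expo (N + 1) d' → k, polyOfCoeffs c = w₂ p) :
    ∃ c : Coord N d' sh.deg sh.size → k,
      (⟨sh, c⟩ : Draw k N d d' smax).output =
        (unitUpper w₁).mulVec fun i => padZero sh.size
          ((unitUpper w₂).mulVec (triBasis hc gc)) (sh.perm i) := by
  choose c₁ hc₁ using h₁
  choose c₂ hc₂ using h₂
  refine ⟨Sum.elim (Sum.elim hc fun p => gc p.1 p.2)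
    (Sum.elim (fun p => c₁ p.1 p.2) fun p => c₂ p.1 p.2), ?_⟩
  have e₁ : w₁ = fun p => polyOfCoeffs (c₁ p) := funext fun p => (hc₁ p).symm
  have e₂ : w₂ = fun p => polyOfCoeffs (c₂ p) := funext fun p => (hc₂ p).symm
  rw [e₁, e₂]
  rfl

lemma isPolyFamily_lastEmb {ι : Type*} {e : ℕ} {v : (ι → k) → Fin e → k}
    (hv : ∀ i, IsPolyFun 1 fun c => v c i) :
    IsPolyFamily 1 fun c => (lastEmb (v c) : MvPolynomial (Fin (N + 1)) k) := by
  simp only [lastEmb_eq_sum_monomial]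
  exact IsPolyFamily.sum _ fun a _ => isPolyFamily_monomial _ (hv a)

lemma isPolyFamily_unitUpper {ι : Type*} {s D : ℕ} {w : (ι → k) → Above s → Expo n D → k}
    (hw : ∀ p a, IsPolyFun 1 fun c => w c p a) (i j : Fin s) :
    IsPolyFamily 1 fun c => unitUpper (fun p => polyOfCoeffs (w c p)) i j := by
  unfold unitUpper
  split_ifs
  · exact IsPolyFamily.sum _ fun a _ => isPolyFamily_monomial _ (hw _ a)
  · exact isPolyFamily_const _ _
  · exact isPolyFamily_const _ _

lemma isPolyFamily_padZero {ι : Type*} {D s m : ℕ} {w : (ι → k) → Fin m → MvPolynomial (Fin n) k}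
    (hw : ∀ j, IsPolyFamily D fun c => w c j) (i : Fin s) :
    IsPolyFamily D fun c => padZero s (w c) i := by
  unfold padZero
  split_ifs
  · exact hw _
  · exact isPolyFamily_const _ _

/-- The output is a product of three factors `U₁`, `U₂'` and `G`, each of degree at most 1 in the
sample; padding and permuting do not raise the degree. -/
lemma isPolyFamily_output (sh : Shape N d smax) (i : Fin sh.size) :
    IsPolyFamily 3 fun c : Coord N d' sh.deg sh.size → k =>
      (⟨sh, c⟩ : Draw k N d d' smax).output i := by
  have hG : ∀ j, IsPolyFamily 1 fun c : Coord N d' sh.deg sh.size → k =>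
      triBasis (⟨sh, c⟩ : Draw k N d d' smax).hCoeff (⟨sh, c⟩ : Draw k N d d' smax).gCoeff j := by
    intro j
    refine Fin.cases ?_ (fun j => ?_) j
    · simp only [triBasis, Fin.cons_zero]
      exact (isPolyFamily_const _ _).add
        (isPolyFamily_lastEmb fun a => isPolyFun_coord le_rfl (Sum.inl (Sum.inl a)))
    · simp only [triBasis, Fin.cons_succ]
      exact (isPolyFamily_const _ _).sub
        (isPolyFamily_lastEmb fun a => isPolyFun_coord le_rfl (Sum.inl (Sum.inr (j, a))))
  have hinner : ∀ j, IsPolyFamily 2 fun c : Coord N d' sh.deg sh.size → k =>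
      (⟨sh, c⟩ : Draw k N d d' smax).inner j :=
    IsPolyFamily.mulVec (D := 1) (D' := 1)
      (isPolyFamily_unitUpper fun p a => isPolyFun_coord le_rfl (Sum.inr (Sum.inr (p, a)))) hG
  have hmiddle : ∀ j : Fin sh.size, IsPolyFamily 2 fun c : Coord N d' sh.deg sh.size → k =>
      (⟨sh, c⟩ : Draw k N d d' smax).middle j := fun j => isPolyFamily_padZero hinner (sh.perm j)
  exact IsPolyFamily.mulVec (D := 1) (D' := 2)
    (isPolyFamily_unitUpper fun p a => isPolyFun_coord le_rfl (Sum.inr (Sum.inl (p, a)))) hmiddle i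

end Sampling

/-! ### At least two variables: the output is generically no Gröbner basis -/

section Genericity

variable {k : Type*} [Field k] {K e : ℕ} {ord : MonomialOrder (Fin (K + 1 + 1))}

/-- The degree of `x_{n-1} - g_{n-1}` if `g_{n-1}` has degree `e - 1`. -/
def genericDegree (ord : MonomialOrder (Fin (K + 1 + 1))) (e : ℕ) : Fin (K + 1 + 1) →₀ ℕ :=
  if ord.toSyn (Finsupp.single (Fin.last K).castSucc 1) <
      ord.toSyn (Finsupp.single (Fin.last (K + 1)) (e - 1)) then
    Finsupp.single (Fin.last (K + 1)) (e - 1)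
  else Finsupp.single (Fin.last K).castSucc 1

lemma le_genericDegree :
    ord.toSyn (Finsupp.single (Fin.last K).castSucc 1) ≤ ord.toSyn (genericDegree ord e) ∧
    ord.toSyn (Finsupp.single (Fin.last (K + 1)) (e - 1)) ≤ ord.toSyn (genericDegree ord e) := by
  unfold genericDegree
  split_ifs with h
  · exact ⟨h.le, le_rfl⟩
  · exact ⟨le_rfl, not_lt.1 h⟩

lemma triBasis_last (hc : Fin e → k) (gc : Fin (K + 1) → Fin e → k) :
    triBasis hc gc (Fin.last (K + 1)) = X (Fin.last K).castSucc - lastEmb (gc (Fin.last K)) := rfl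

lemma degree_triBasis_last_le (hc : Fin e → k) (gc : Fin (K + 1) → Fin e → k) :
    ord.toSyn (ord.degree (triBasis hc gc (Fin.last (K + 1)))) ≤
      ord.toSyn (genericDegree ord e) := by
  refine ord.degree_le_iff.2 fun b hb => ?_
  rcases exists_of_mem_support_triBasis hb with rfl | ⟨b, rfl⟩
  · exact le_genericDegree.1
  · refine le_trans (ord.toSyn_monotone (Finsupp.single_mono ?_)) le_genericDegree.2
    have := b.2
    omega

lemma coeff_genericDegree_ne_zero (he : 0 < e) (hc : Fin e → k) :
    coeff (genericDegree ord e)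
      (triBasis hc (fun (_ : Fin (K + 1)) (_ : Fin e) => (1 : k)) (Fin.last (K + 1))) ≠ 0 := by
  classical
  have hne := (Fin.castSucc_lt_last (Fin.last K)).ne
  have hsingle : ∀ b : ℕ, Finsupp.single (Fin.last (K + 1)) b ≠
      Finsupp.single (Fin.last K).castSucc 1 := by
    intro b h
    have := DFunLike.congr_fun h (Fin.last K).castSucc
    rw [Finsupp.single_eq_of_ne hne, Finsupp.single_eq_same] at this
    omega
  rw [triBasis_last, coeff_sub]
  unfold genericDegree
  split_ifs with h
  · have h1 := coeff_lastEmb_single (N := K + 1) (fun _ : Fin e => (1 : k)) ⟨e - 1, by omega⟩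
    rw [h1, X, coeff_monomial, if_neg (hsingle _).symm]
    simp
  · have h1 : coeff (Finsupp.single (Fin.last K).castSucc 1)
        (lastEmb (fun _ : Fin e => (1 : k)) : MvPolynomial (Fin (K + 1 + 1)) k) = 0 := by
      by_contra h0
      obtain ⟨b, hb⟩ := exists_of_mem_support_lastEmb (mem_support_iff.2 h0)
      exact hsingle _ hb.symm
    rw [h1, X, coeff_monomial, if_pos rfl]
    simp

/-- There are more than `e` terms that are not multiples of the generic degree and smaller than its
product with the largest variable. -/
lemma exists_small_terms (he : 0 < e) {m : Fin (K + 1 + 1)}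
    (hm : ∀ j, ord.toSyn (Finsupp.single j 1) ≤ ord.toSyn (Finsupp.single m 1)) :
    ∃ T : Finset (Fin (K + 1 + 1) →₀ ℕ), e < T.card ∧ ∀ t ∈ T,
      ord.toSyn t < ord.toSyn (Finsupp.single m 1 + genericDegree ord e) ∧
        ¬ genericDegree ord e ≤ t := by
  classical
  have hne := (Fin.castSucc_lt_last (Fin.last K)).ne
  unfold genericDegree
  split_ifs with h
  -- Here δ = x_n^{e-1} exceeds x_{n-1}. The terms are the `e - 1` smaller powers of x_n together
  -- with x_{n-1} and its square; the square is below x_m δ because x_{n-1} ≤ x_m and x_{n-1} < δ.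
  · have he2 : 2 ≤ e := by
      by_contra h2
      rw [show e - 1 = 0 by omega, Finsupp.single_zero, map_zero] at h
      exact absurd h (not_lt.2 (ord.zero_le _))
    have hlt : ord.toSyn (Finsupp.single (Fin.last (K + 1)) (e - 1)) <
        ord.toSyn (Finsupp.single m 1 + Finsupp.single (Fin.last (K + 1)) (e - 1)) :=
      ord.toSyn_strictMono (lt_add_of_pos_left _ (pos_iff_ne_zero.2 (by simp)))
    refine ⟨(Finset.range (e - 1)).image (Finsupp.single (Fin.last (K + 1))) ∪
      {Finsupp.single (Fin.last K).castSucc 1, Finsupp.single (Fin.last K).castSucc 2}, ?_, ?_⟩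
    · rw [Finset.card_union_of_disjoint, Finset.card_image_of_injective _
        (Finsupp.single_injective _), Finset.card_range, Finset.card_pair]
      · omega
      · exact fun h => by simpa using Finsupp.single_injective _ h
      · rw [Finset.disjoint_left]
        intro a ha hb
        obtain ⟨b, -, rfl⟩ := Finset.mem_image.1 ha
        simp only [Finset.mem_insert, Finset.mem_singleton] at hb
        rcases hb with hb | hb <;>
        · have := DFunLike.congr_fun hb (Fin.last K).castSucc
          rw [Finsupp.single_eq_of_ne hne, Finsupp.single_eq_same] at this
          omega
    · intro t ht
      have hp : ∀ b, ¬ Finsupp.single (Fin.last (K + 1)) (e - 1) ≤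
          Finsupp.single (Fin.last K).castSucc b := by
        intro b hle
        have := hle (Fin.last (K + 1))
        rw [Finsupp.single_eq_same, Finsupp.single_eq_of_ne hne.symm] at this
        omega
      simp only [Finset.mem_union, Finset.mem_image, Finset.mem_range, Finset.mem_insert,
        Finset.mem_singleton] at ht
      rcases ht with ⟨b, hb, rfl⟩ | rfl | rfl
      · refine ⟨lt_of_le_of_lt (ord.toSyn_monotone (Finsupp.single_mono hb.le)) hlt, fun hle => ?_⟩
        have := hle (Fin.last (K + 1))
        simp at this
        omega
      · exact ⟨h.trans hlt, hp 1⟩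
      · refine ⟨?_, hp 2⟩
        rw [show (2 : ℕ) = 1 + 1 from rfl, Finsupp.single_add, map_add, map_add]
        exact add_lt_add_of_le_of_lt (hm _) h
  -- Here δ = x_{n-1}. The terms are 1, x_n, …, x_n^e, and x_n^e = x_n · x_n^{e-1} ≤ x_m x_{n-1},
  -- where equality fails because x_{n-1} does not divide the left side.
  · refine ⟨(Finset.range (e + 1)).image (Finsupp.single (Fin.last (K + 1))), ?_, ?_⟩
    · rw [Finset.card_image_of_injective _ (Finsupp.single_injective _), Finset.card_range]
      omega
    · intro t ht
      obtain ⟨b, hb, rfl⟩ := Finset.mem_image.1 ht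
      rw [Finset.mem_range] at hb
      constructor
      · have h1 : ord.toSyn (Finsupp.single (Fin.last (K + 1)) b) ≤
            ord.toSyn (Finsupp.single m 1 + Finsupp.single (Fin.last K).castSucc 1) := by
          refine (ord.toSyn_monotone (Finsupp.single_mono (show b ≤ 1 + (e - 1) by omega))).trans ?_
          rw [Finsupp.single_add, map_add, map_add]
          exact add_le_add (hm _) (not_lt.1 h)
        refine lt_of_le_of_ne h1 fun heq => ?_
        have := DFunLike.congr_fun (ord.toSyn.injective heq) (Fin.last K).castSucc
        rw [Finsupp.single_eq_of_ne hne] at this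
        simp at this
      · intro hle
        have := hle (Fin.last K).castSucc
        rw [Finsupp.single_eq_same, Finsupp.single_eq_of_ne hne] at this
        omega

variable {d d' smax : ℕ}

/-- Rows of `P U₂ G` with `perm j ≥ N + 1` are padding. The last other row is left unchanged by
`U₁`, as only zeros follow it. -/
lemma exists_last_nonzero {N : ℕ} (sh : Shape N d smax) :
    ∃ l : Fin sh.size, (sh.perm l : ℕ) < N + 1 ∧ ∀ j, l < j → ¬ (sh.perm j : ℕ) < N + 1 := by
  classical
  obtain ⟨l, hl, hmax⟩ := Finset.exists_max_image
    (Finset.univ.filter fun j : Fin sh.size => (sh.perm j : ℕ) < N + 1) id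
    ⟨sh.perm.symm ⟨0, by have := sh.le_size; omega⟩, by simp⟩
  refine ⟨l, (Finset.mem_filter.1 hl).2, fun j hj hlt => ?_⟩
  exact absurd (hmax j (by simpa using hlt)) (not_le.2 hj)

namespace Draw

lemma inner_last {N : ℕ} (ω : Draw k N d d' smax) :
    ω.inner (Fin.last N) = triBasis ω.hCoeff ω.gCoeff (Fin.last N) :=
  unitUpper_mulVec_last _ _

lemma output_eq_middle {N : ℕ} (ω : Draw k N d d' smax) {l : Fin ω.shape.size}
    (hl : ∀ j, l < j → ¬ (ω.shape.perm j : ℕ) < N + 1) (i : Fin ω.shape.size) (hi : l ≤ i) :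
    ω.output i = ω.middle i :=
  unitUpper_mulVec_of_zero (fun j hj => by simp [middle, padZero, hl j hj]) i hi

lemma output_eq_zero {N : ℕ} (ω : Draw k N d d' smax) {l : Fin ω.shape.size}
    (hl : ∀ j, l < j → ¬ (ω.shape.perm j : ℕ) < N + 1) {i : Fin ω.shape.size} (hi : l < i) :
    ω.output i = 0 := by
  rw [ω.output_eq_middle hl i hi.le]
  simp [middle, padZero, hl i hi]

/-- The exceptional position: the last row of `U₂'` is a unit vector, and `U₁` has only zeros to
add, so no choice of matrices changes this entry. -/
lemma output_eq_triBasis_last (ω : Draw k (K + 1) d d' smax) {l : Fin ω.shape.size}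
    (hl : ∀ j, l < j → ¬ (ω.shape.perm j : ℕ) < K + 1 + 1)
    (hperm : (ω.shape.perm l : ℕ) = K + 1) :
    ω.output l = triBasis ω.hCoeff ω.gCoeff (Fin.last (K + 1)) := by
  rw [ω.output_eq_middle hl l le_rfl, ← inner_last]
  simp only [middle, padZero]
  rw [dif_pos (by omega)]
  congr 1
  exact Fin.ext hperm

end Draw

/-- For suitable samples, the `i`-th entry of the output has a nonzero coefficient at the product of
the generic degree and a variable. -/
lemma exists_coeff_output_ne_zero (sh : Shape (K + 1) d smax) (hd' : 0 < d') (m : Fin (K + 1 + 1))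
    {l : Fin sh.size} (hl0 : (sh.perm l : ℕ) < K + 1 + 1) {i : Fin sh.size} (hil : i ≤ l)
    (hi : i = l → (sh.perm l : ℕ) ≠ K + 1) :
    ∃ c : Coord (K + 1) d' sh.deg sh.size → k,
      coeff (Finsupp.single m 1 + genericDegree ord sh.deg)
        ((⟨sh, c⟩ : Draw k (K + 1) d d' smax).output i) ≠ 0 := by
  classical
  set hc : Fin sh.deg → k := 0
  set gc : Fin (K + 1) → Fin sh.deg → k := fun _ _ => 1 with hgc
  set B := triBasis hc gc (Fin.last (K + 1)) with hB
  have hB0 : coeff (genericDegree ord sh.deg) B ≠ 0 :=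
    coeff_genericDegree_ne_zero sh.deg_pos hc
  -- It suffices to realize A + zB for both z = 0 and z = x_m. If A has coefficient zero at x_m δ,
  -- then z = x_m gives the coefficient of B at δ, which is nonzero; otherwise z = 0 works.
  suffices h : ∃ (A : MvPolynomial (Fin (K + 1 + 1)) k), ∀ z : MvPolynomial (Fin (K + 1 + 1)) k,
      (∃ c : Expo (K + 1 + 1) d' → k, polyOfCoeffs c = z) →
      ∃ c : Coord (K + 1) d' sh.deg sh.size → k,
        (⟨sh, c⟩ : Draw k (K + 1) d d' smax).output i = A + z * B by
    obtain ⟨A, hA⟩ := h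
    obtain ⟨c₀, h₀⟩ := hA 0 (exists_polyOfCoeffs_zero d')
    obtain ⟨c₁, h₁⟩ := hA (X m) (exists_polyOfCoeffs_X hd' m)
    by_cases h0 : coeff (Finsupp.single m 1 + genericDegree ord sh.deg) A = 0
    · refine ⟨c₁, ?_⟩
      rw [h₁, coeff_add, h0, zero_add, coeff_X_mul]
      exact hB0
    · exact ⟨c₀, by rwa [h₀, zero_mul, add_zero]⟩
  have helem : ∀ {s : ℕ} (a b : Fin s) (z : MvPolynomial (Fin (K + 1 + 1)) k),
      (∃ c : Expo (K + 1 + 1) d' → k, polyOfCoeffs c = z) →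
      ∀ p, ∃ c : Expo (K + 1 + 1) d' → k, polyOfCoeffs c = elementary a b z p := by
    intro s a b z hz p
    unfold elementary
    split_ifs
    exacts [hz, exists_polyOfCoeffs_zero d']
  have hzero : ∀ {s : ℕ} (p : Above s), ∃ c : Expo (K + 1 + 1) d' → k,
      polyOfCoeffs c = (0 : Above s → MvPolynomial (Fin (K + 1 + 1)) k) p :=
    fun p => exists_polyOfCoeffs_zero d'
  by_cases hperm : (sh.perm l : ℕ) = K + 1
  -- B sits in position `l`, and `U₁` adds z times this entry to position `i`.
  · have hlt : i < l := lt_of_le_of_ne hil fun h => hi h hperm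
    refine ⟨padZero sh.size (triBasis hc gc) (sh.perm i), fun z hz => ?_⟩
    obtain ⟨c, hcz⟩ := exists_output_eq sh hc gc (helem i l z hz) (hzero (s := K + 1 + 1))
    refine ⟨c, ?_⟩
    rw [hcz, unitUpper_elementary_mulVec hlt, unitUpper_zero, Matrix.one_mulVec, if_pos rfl]
    congr 2
    simp only [padZero]
    rw [dif_pos hl0, hB]
    congr 1
    exact Fin.ext hperm
  -- Position `l` comes from another row `r` of `U₂' G`, so `U₂'` adds zB to that row. For `i < l`,
  -- `U₁` then copies position `l` into position `i` with factor 1.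
  · set r : Fin (K + 1 + 1) := ⟨sh.perm l, hl0⟩ with hr
    have hrl : r < Fin.last (K + 1) := by
      rw [Fin.lt_def]
      simp only [hr, Fin.val_last]
      omega
    have hmid : ∀ (z : MvPolynomial (Fin (K + 1 + 1)) k) (j : Fin sh.size),
        padZero sh.size ((unitUpper (elementary r (Fin.last (K + 1)) z)).mulVec (triBasis hc gc))
          (sh.perm j) = padZero sh.size (triBasis hc gc) (sh.perm j) +
            if j = l then z * B else 0 := by
      intro z j
      simp only [padZero]
      split_ifs with h1 h2 h2
      · rw [unitUpper_elementary_mulVec hrl, if_pos (by rw [hr]; exact Fin.ext (by simp [h2]))]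
      · rw [unitUpper_elementary_mulVec hrl, if_neg]
        intro h3
        rw [hr, Fin.mk.injEq] at h3
        exact h2 (sh.perm.injective (Fin.ext h3))
      · exact absurd (h2 ▸ hl0) h1
      · simp
    rcases eq_or_lt_of_le hil with rfl | hlt
    · refine ⟨padZero sh.size (triBasis hc gc) (sh.perm i), fun z hz => ?_⟩
      obtain ⟨c, hcz⟩ := exists_output_eq sh hc gc (hzero (s := sh.size))
        (helem r (Fin.last (K + 1)) z hz)
      refine ⟨c, ?_⟩
      rw [hcz, unitUpper_zero, Matrix.one_mulVec, hmid, if_pos rfl]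
    · refine ⟨padZero sh.size (triBasis hc gc) (sh.perm i) +
        padZero sh.size (triBasis hc gc) (sh.perm l), fun z hz => ?_⟩
      obtain ⟨c, hcz⟩ := exists_output_eq sh hc gc (helem i l 1 (exists_polyOfCoeffs_one d'))
        (helem r (Fin.last (K + 1)) z hz)
      refine ⟨c, ?_⟩
      rw [hcz, unitUpper_elementary_mulVec hlt, if_pos rfl]
      simp only [hmid, if_neg hlt.ne, if_true]
      ring

open Classical in
/-- If the output is a Gröbner basis, then the sampled coefficients are zeros of a nonzero
polynomial. -/
lemma exists_polynomial_of_isGroebnerBasis (sh : Shape (K + 1) d smax) (hd' : 0 < d')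
    (ord : MonomialOrder (Fin (K + 1 + 1))) :
    ∃ Q : MvPolynomial (Coord (K + 1) d' sh.deg sh.size) k, Q ≠ 0 ∧
      Q.totalDegree ≤ 3 * sh.size ∧ ∀ c,
        IsGroebnerBasis ord (Finset.univ.image (⟨sh, c⟩ : Draw k (K + 1) d d' smax).output)
          (triIdeal (⟨sh, c⟩ : Draw k (K + 1) d d' smax).hCoeff
            (⟨sh, c⟩ : Draw k (K + 1) d d' smax).gCoeff) →
        eval c Q = 0 := by
  obtain ⟨m, hm⟩ := Finite.exists_max fun j : Fin (K + 1 + 1) => ord.toSyn (Finsupp.single j 1)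
  obtain ⟨l, hl0, hl⟩ := exists_last_nonzero sh
  -- Entries after position `l` are zero and play no role among leading terms, so they get the
  -- harmless factor 1.
  let φ : Fin sh.size → (Coord (K + 1) d' sh.deg sh.size → k) → k := fun i c =>
    if i ≤ l then
      if i = l ∧ (sh.perm l : ℕ) = K + 1 then
        coeff (genericDegree ord sh.deg) ((⟨sh, c⟩ : Draw k (K + 1) d d' smax).output i)
      else coeff (Finsupp.single m 1 + genericDegree ord sh.deg)
        ((⟨sh, c⟩ : Draw k (K + 1) d d' smax).output i)
    else 1
  have hφ : ∀ i, IsPolyFun 3 (φ i) := by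
    intro i
    simp only [φ]
    split_ifs
    · exact isPolyFamily_output sh i _
    · exact isPolyFamily_output sh i _
    · exact isPolyFun_const _ _
  have hφ0 : ∀ i, ∃ c, φ i c ≠ 0 := by
    intro i
    simp only [φ]
    split_ifs with h1 h2
    · obtain ⟨rfl, hperm⟩ := h2
      obtain ⟨c, hc⟩ : ∃ c : Coord (K + 1) d' sh.deg sh.size → k,
          (⟨sh, c⟩ : Draw k (K + 1) d d' smax).gCoeff = fun _ _ => 1 :=
        ⟨fun _ => 1, rfl⟩
      refine ⟨c, ?_⟩
      rw [(⟨sh, c⟩ : Draw k (K + 1) d d' smax).output_eq_triBasis_last hl hperm, hc]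
      exact coeff_genericDegree_ne_zero sh.deg_pos _
    · exact exists_coeff_output_ne_zero sh hd' m hl0 h1 fun h h' => h2 ⟨h, h'⟩
    · exact ⟨0, one_ne_zero⟩
  obtain ⟨Q, hQ0, hQdeg, hQ⟩ := exists_polynomial_of_isPolyFun hφ hφ0
  refine ⟨Q, hQ0, hQdeg, fun c hGB => hQ c ?_⟩
  by_contra! hne
  set ω : Draw k (K + 1) d d' smax := ⟨sh, c⟩ with hω
  have hbig : ∀ i, i ≤ l → ¬ (i = l ∧ (sh.perm l : ℕ) = K + 1) →
      ord.toSyn (Finsupp.single m 1 + genericDegree ord sh.deg) ≤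
        ord.toSyn (ord.degree (ω.output i)) := by
    intro i h1 h2
    have := hne i
    simp only [φ, if_pos h1, if_neg h2] at this
    exact ord.le_degree (mem_support_iff.2 this)
  have hzero : ∀ i, ω.output i ≠ 0 → i ≤ l := fun i h0 => by
    by_contra hlt
    exact h0 (ω.output_eq_zero hl (not_le.1 hlt))
  by_cases hperm : (sh.perm l : ℕ) = K + 1
  -- B is the entry in position `l`, with leading exponent exactly δ. The leading term of `f` lies
  -- in `T`, hence is no multiple of δ and is too small for every other entry.
  · obtain ⟨T, hTcard, hT⟩ := exists_small_terms (ord := ord) sh.deg_pos hm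
    obtain ⟨f, hfI, hf0, hfT⟩ := exists_mem_triIdeal_support_subset (hc := ω.hCoeff)
      (gc := ω.gCoeff) sh.deg_pos T hTcard
    obtain ⟨g, hg, hg0, hle⟩ := hGB.exists_degree_le hfI hf0
    obtain ⟨i, -, rfl⟩ := Finset.mem_image.1 hg
    obtain ⟨ht1, ht2⟩ := hT _ (hfT (ord.degree_mem_support hf0))
    by_cases hil : i = l
    · subst hil
      have hlast := ω.output_eq_triBasis_last hl hperm
      have hcoef := hne i
      simp only [φ, le_refl, if_true, hperm, and_self] at hcoef
      refine ht2 (le_trans (le_of_eq ?_) hle)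
      refine ord.toSyn.injective (le_antisymm (ord.le_degree (mem_support_iff.2 hcoef)) ?_)
      rw [hlast]
      exact degree_triBasis_last_le _ _
    · exact absurd (ord.toSyn_monotone hle) (not_le.2
        (ht1.trans_le (hbig i (hzero i hg0) fun h => hil h.1)))
  -- All nonzero entries have leading terms at least x_m δ, while B is in the ideal with leading
  -- term at most δ.
  · have hf0 : triBasis ω.hCoeff ω.gCoeff (Fin.last (K + 1)) ≠ 0 := by
      intro h
      have := coeff_triBasis (hc := ω.hCoeff) (gc := ω.gCoeff) (Fin.last (K + 1))
      rw [h, coeff_zero] at this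
      exact zero_ne_one this
    obtain ⟨g, hg, hg0, hle⟩ := hGB.exists_degree_le (triBasis_mem _) hf0
    obtain ⟨i, -, rfl⟩ := Finset.mem_image.1 hg
    have h1 := hbig i (hzero i hg0) fun h => hperm h.2
    have h2 : ord.toSyn (genericDegree ord sh.deg) <
        ord.toSyn (Finsupp.single m 1 + genericDegree ord sh.deg) :=
      ord.toSyn_strictMono (lt_add_of_pos_left _ (pos_iff_ne_zero.2 (by simp)))
    exact absurd ((ord.toSyn_monotone hle).trans (degree_triBasis_last_le _ _))
      (not_le.2 (h2.trans_le h1))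

end Genericity

/-! ### One variable, and assembly of the theorem -/

section Main

open Classical in
/-- In one variable, the output is not the reduced Gröbner basis, unless an entry of `U₁` is
constant. -/
lemma exists_polynomial_of_isReducedGroebnerBasis {k : Type*} [Field k] {d d' smax : ℕ}
    (sh : Shape 0 d smax) (hd' : 0 < d') (hsize : 2 ≤ sh.size) (ord : MonomialOrder (Fin (0 + 1))) :
    ∃ Q : MvPolynomial (Coord 0 d' sh.deg sh.size) k, Q ≠ 0 ∧ Q.totalDegree ≤ 3 * sh.size ∧ ∀ c,
      IsReducedGroebnerBasis ord (Finset.univ.image (⟨sh, c⟩ : Draw k 0 d d' smax).output)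
          (triIdeal (⟨sh, c⟩ : Draw k 0 d d' smax).hCoeff
            (⟨sh, c⟩ : Draw k 0 d d' smax).gCoeff) →
        eval c Q = 0 := by
  let first : Fin sh.size := ⟨0, by omega⟩
  let last : Fin sh.size := ⟨sh.size - 1, by omega⟩
  have hfl : first < last := by rw [Fin.lt_def]; simp only [first, last]; omega
  have hle : ∀ j, j ≤ last := fun j => by
    rw [Fin.le_def]
    have := j.2
    simp only [last]
    omega
  -- The coefficient at x_1 of the upper right corner of `U₁`; it is among the sampled ones because
  -- `d' > 0`.
  let x : Coord 0 d' sh.deg sh.size :=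
    Sum.inr (Sum.inl (⟨(first, last), hfl⟩, Expo.single hd' 0))
  refine ⟨X x, X_ne_zero _, by rw [totalDegree_X]; omega, fun c hred => ?_⟩
  rw [eval_X]
  set ω : Draw k 0 d d' smax := ⟨sh, c⟩ with hω
  have hmem : ∀ i, ω.output i ∈ Finset.univ.image ω.output := fun i =>
    Finset.mem_image_of_mem _ (Finset.mem_univ i)
  have hne : ∀ i, ω.output i ≠ 0 := fun i h0 => by
    have := (hred.2 _ (hmem i)).1
    rw [h0, ord.leadingCoeff_zero] at this
    exact zero_ne_one this
  have hlast : ω.output last = ω.middle last :=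
    ω.output_eq_middle (l := last) (fun j hj => absurd hj (not_lt.2 (hle j))) last le_rfl
  -- Elements of a reduced basis are monic, hence nonzero, so the only row that is not padding must
  -- be the last one.
  have hperm : (sh.perm last : ℕ) < 0 + 1 := by
    by_contra h
    refine hne last (hlast.trans ?_)
    simp only [Draw.middle, padZero]
    exact dif_neg h
  have hzero : ∀ j, j ≠ last → ω.middle j = 0 := by
    intro j hj
    simp only [Draw.middle, padZero]
    refine dif_neg fun h => hj (sh.perm.injective (Fin.ext ?_))
    have h' : (sh.perm j : ℕ) < 0 + 1 := h
    omega
  have hfirst : ω.output first = ω.U₁ first last * ω.output last := by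
    rw [hlast]
    change ∑ j, ω.U₁ first j * ω.middle j = _
    exact Finset.sum_eq_single last (fun j _ hj => by rw [hzero j hj, mul_zero]) (by simp)
  have hU : ω.U₁ first last = polyOfCoeffs fun a =>
      c (Sum.inr (Sum.inl (⟨(first, last), hfl⟩, a))) := by
    change unitUpper _ first last = _
    rw [unitUpper, dif_pos hfl]
  have hu0 : ω.U₁ first last ≠ 0 := fun h => hne first (by rw [hfirst, h, zero_mul])
  -- The first entry is a multiple of the last one, so its leading term is divisible by that of the
  -- last; in a reduced basis the two must coincide.
  have heq : ω.output last = ω.output first := by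
    by_contra hcon
    refine (hred.2 _ (hmem first)).2 _ (ord.degree_mem_support (hne first)) ?_
    refine monomial_mem_span_leadingTerm_iff.2 ⟨ω.output last, ⟨hmem last, hcon⟩, hne last, ?_⟩
    rw [hfirst, ord.degree_mul hu0 (hne last)]
    exact le_add_self
  have hone : ω.U₁ first last = 1 := by
    refine mul_right_cancel₀ (hne last) ?_
    rw [← hfirst, one_mul, heq]
  have hcoef := coeff_polyOfCoeffs (fun a => c (Sum.inr (Sum.inl (⟨(first, last), hfl⟩, a))))
    (Expo.single hd' 0)
  rw [← hU, hone, Expo.toFinsupp_single, coeff_one, if_neg] at hcoef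
  · exact hcoef.symm
  · intro h
    have := DFunLike.congr_fun h 0
    simp at this

open Classical in
lemma exists_polynomial_genericity {k : Type*} [Field k] {N d d' smax : ℕ}
    (sh : Shape N d smax) (hd' : 0 < d') (ord : MonomialOrder (Fin (N + 1))) :
    ∃ Q : MvPolynomial (Coord N d' sh.deg sh.size) k, Q ≠ 0 ∧ Q.totalDegree ≤ 3 * sh.size ∧ ∀ c,
      (2 ≤ sh.size →
        IsReducedGroebnerBasis ord (Finset.univ.image (⟨sh, c⟩ : Draw k N d d' smax).output)
          (triIdeal (⟨sh, c⟩ : Draw k N d d' smax).hCoeff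
            (⟨sh, c⟩ : Draw k N d d' smax).gCoeff) → eval c Q = 0) ∧
      (1 ≤ N →
        IsGroebnerBasis ord (Finset.univ.image (⟨sh, c⟩ : Draw k N d d' smax).output)
          (triIdeal (⟨sh, c⟩ : Draw k N d d' smax).hCoeff
            (⟨sh, c⟩ : Draw k N d d' smax).gCoeff) → eval c Q = 0) := by
  cases N with
  | zero =>
    by_cases hs : 2 ≤ sh.size
    · obtain ⟨Q, h0, h1, h2⟩ := exists_polynomial_of_isReducedGroebnerBasis (k := k) sh hd' hs ord
      exact ⟨Q, h0, h1, fun c => ⟨fun _ => h2 c, fun h => absurd h (by omega)⟩⟩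
    -- For `N = 0` and size 1 both implications are vacuous, so any nonzero constant serves.
    · exact ⟨1, one_ne_zero, by simp, fun c =>
        ⟨fun h => absurd h hs, fun h => absurd h (by omega)⟩⟩
  | succ K =>
    obtain ⟨Q, h0, h1, h2⟩ := exists_polynomial_of_isGroebnerBasis (k := k) sh hd' ord
    exact ⟨Q, h0, h1, fun c => ⟨fun _ h => h2 c h.1, fun _ => h2 c⟩⟩

namespace Draw

variable {k : Type*} [Field k] {N d d' smax : ℕ}

lemma generatePair_val_isReduced (ω : Draw k N d d' smax) (S M : ℕ → ℕ → ℕ)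
    (ord : MonomialOrder (Fin (N + 1))) :
    IsReducedGroebnerBasis ord (generatePair S M ord ω).val.2 (triIdeal ω.hCoeff ω.gCoeff) := by
  classical
  by_cases h : IsLex ord
  · rw [ω.generatePair_val_lex S M h]
    convert isReducedGroebnerBasis_triBasis ω.shape.deg_pos h.single_last_lt
  · rw [ω.generatePair_val_not_lex S M h]
    convert fglm_isReducedGroebnerBasis ω.shape.deg_pos

open Classical in
lemma generatePair_val_fst (ω : Draw k N d d' smax) (S M : ℕ → ℕ → ℕ)
    (ord : MonomialOrder (Fin (N + 1))) :
    (generatePair S M ord ω).val.1 = Finset.univ.image ω.output := by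
  by_cases h : IsLex ord
  · rw [ω.generatePair_val_lex S M h]
  · rw [ω.generatePair_val_not_lex S M h]

lemma span_generatePair_fst (ω : Draw k N d d' smax) (S M : ℕ → ℕ → ℕ)
    (ord : MonomialOrder (Fin (N + 1))) :
    Ideal.span ((generatePair S M ord ω).val.1 : Set (MvPolynomial (Fin (N + 1)) k)) =
      triIdeal ω.hCoeff ω.gCoeff := by
  classical
  rw [generatePair_val_fst, span_image_output]

/-- `IsGroebnerBasis` asks only for containment and leading terms. Generation follows by division,
since a nonzero element of the ideal always has a leading term divisible by one of the basis. -/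
lemma span_generatePair_snd (ω : Draw k N d d' smax) (S M : ℕ → ℕ → ℕ)
    (ord : MonomialOrder (Fin (N + 1))) :
    Ideal.span ((generatePair S M ord ω).val.2 : Set (MvPolynomial (Fin (N + 1)) k)) =
      triIdeal ω.hCoeff ω.gCoeff := by
  have h := ω.generatePair_val_isReduced S M ord
  refine span_eq_of_remainder_eq_zero (ord := ord) (fun g hg => h.1.1 hg)
    (fun g hg => (h.2 g hg).1) fun r hr hsupp => ?_
  by_contra hr0
  obtain ⟨g, hg, -, hle⟩ := h.1.exists_degree_le hr hr0
  exact hsupp _ (ord.degree_mem_support hr0) g hg hle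

lemma card_generatePair_fst_le (ω : Draw k N d d' smax) (S M : ℕ → ℕ → ℕ)
    (ord : MonomialOrder (Fin (N + 1))) : (generatePair S M ord ω).val.1.card ≤ smax := by
  classical
  rw [generatePair_val_fst]
  refine Finset.card_image_le.trans ?_
  simpa using ω.shape.size_le

lemma card_generatePair_snd_of_isLex (ω : Draw k N d d' smax) (S M : ℕ → ℕ → ℕ)
    {ord : MonomialOrder (Fin (N + 1))} (h : IsLex ord) :
    (generatePair S M ord ω).val.2.card = N + 1 := by
  classical
  rw [ω.generatePair_val_lex S M h, Finset.card_image_of_injective _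
    (triBasis_injective ω.shape.deg_pos)]
  simp

end Draw

end Main

end

theorem mainTheorem3 :
    ∃ C : ℕ, ∀ (N d d' smax : ℕ), 0 < d → 0 < d' → N + 1 ≤ smax →
      ∀ (k : Type u) [Field k] (ord : MonomialOrder.{0, v} (Fin (N + 1))),
        ∃ Q : ∀ sh : Shape N d smax, MvPolynomial (Coord N d' sh.deg sh.size) k,
          (∀ sh, Q sh ≠ 0 ∧ (Q sh).totalDegree ≤ C * sh.size ∧
            ∀ B : Finset k, B.Nonempty → zeroProportion (Q sh) B ≤ C * sh.size / B.card) ∧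
          ∀ (S M : ℕ → ℕ → ℕ), (∀ n, Monotone (S n)) → (∀ n, Monotone (M n)) →
            (∀ n D, (n + D).choose n ≤ S n D) → (∀ n D, (n + D).choose n ≤ M n D) →
            ∀ (m : ℕ) (ω : Fin m → Draw k N d d' smax),
              (∀ i, ∀ F G : Finset (MvPolynomial (Fin (N + 1)) k),
                (generateDataset S M ord ω).val i = (F, G) →
                  (F.card ≤ smax ∧ N + 1 ≤ G.card ∧ (IsLex ord → G.card = N + 1)) ∧
                  IsReducedGroebnerBasis ord G (Ideal.span F) ∧
                  (2 ≤ (ω i).shape.size → IsReducedGroebnerBasis ord F (Ideal.span F) →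
                    MvPolynomial.eval (ω i).coeff (Q (ω i).shape) = 0) ∧
                  (1 ≤ N → IsGroebnerBasis ord F (Ideal.span F) →
                    MvPolynomial.eval (ω i).coeff (Q (ω i).shape) = 0) ∧
                  Ideal.span (F : Set (MvPolynomial (Fin (N + 1)) k)) = Ideal.span G ∧
                  IsZeroDimensional (Ideal.span (F : Set (MvPolynomial (Fin (N + 1)) k))) ∧
                  IsInShapePosition (Ideal.span (F : Set (MvPolynomial (Fin (N + 1)) k)))) ∧
              (IsLex ord → (generateDataset S M ord ω).cost ≤
                C * ∑ i, ((N + 1) * S 1 d + (ω i).shape.size ^ 2 * S (N + 1) d' +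
                  ((N + 1) ^ 2 + (ω i).shape.size ^ 2) * M (N + 1) (2 * d' + d))) ∧
              (¬ IsLex ord → (generateDataset S M ord ω).cost ≤
                C * (∑ i, ((N + 1) * S 1 d + (ω i).shape.size ^ 2 * S (N + 1) d' +
                  ((N + 1) ^ 2 + (ω i).shape.size ^ 2) * M (N + 1) (2 * d' + d)) +
                  m * (N + 1) * d ^ 3)) := by
  classical
  -- The constant 21 comes from `fglm_cost_le`; it dominates 3 for the degree of Q, 2 for sampling
  -- the basis and 4 for the transformation.
  refine ⟨21, fun N d d' smax _ hd' _ k _ ord => ?_⟩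
  choose Q hQ0 hQdeg hQ using fun sh : Shape N d smax =>
    exists_polynomial_genericity (k := k) sh hd' ord
  refine ⟨Q, fun sh => ⟨hQ0 sh, (hQdeg sh).trans (by omega), fun B _ => ?_⟩, ?_⟩
  · refine (zeroProportion_le (hQ0 sh) B).trans ?_
    have h : ((Q sh).totalDegree : ℚ) ≤ (21 : ℕ) * sh.size := by
      exact_mod_cast (hQdeg sh).trans (by omega)
    gcongr
  intro S M hS hM hS' hM' m ω
  refine ⟨fun i F G hFG => ?_, fun h => ?_, fun h => ?_⟩
  · have hFG' : (generatePair S M ord (ω i)).val = (F, G) := hFG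
    have hF : F = (generatePair S M ord (ω i)).val.1 := by rw [hFG']
    have hG : G = (generatePair S M ord (ω i)).val.2 := by rw [hFG']
    have hspan : Ideal.span (F : Set (MvPolynomial (Fin (N + 1)) k)) =
        triIdeal (ω i).hCoeff (ω i).gCoeff := by rw [hF, Draw.span_generatePair_fst]
    have hred : IsReducedGroebnerBasis ord G (triIdeal (ω i).hCoeff (ω i).gCoeff) := by
      rw [hG]
      exact (ω i).generatePair_val_isReduced S M ord
    rw [hspan]
    refine ⟨⟨?_, hred.1.le_card (ω i).shape.deg_pos, fun h => ?_⟩, hred, ?_, ?_, ?_,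
      isZeroDimensional_triIdeal (ω i).shape.deg_pos,
      isInShapePosition_triIdeal (ω i).shape.deg_pos⟩
    · rw [hF]
      exact (ω i).card_generatePair_fst_le S M ord
    · rw [hG]
      exact (ω i).card_generatePair_snd_of_isLex S M h
    · rw [hF, Draw.generatePair_val_fst]
      exact (hQ (ω i).shape (ω i).coeff).1
    · rw [hF, Draw.generatePair_val_fst]
      exact (hQ (ω i).shape (ω i).coeff).2
    · rw [hG, Draw.span_generatePair_snd]
  · simp only [generateDataset, Timed.cost_all, Finset.mul_sum]
    refine Finset.sum_le_sum fun i _ => ?_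
    rw [(ω i).generatePair_cost_lex S M h]
    have h1 := (ω i).sampleBasis_cost_le (hS 1) (hS' 1)
    have h2 := (ω i).backwardTransform_cost_le (hM (N + 1)) (hS' (N + 1)) (hM' (N + 1))
    omega
  · have h0 : m * (N + 1) * d ^ 3 = ∑ _i : Fin m, (N + 1) * d ^ 3 := by simp [mul_assoc]
    rw [h0, ← Finset.sum_add_distrib]
    simp only [generateDataset, Timed.cost_all, Finset.mul_sum]
    refine Finset.sum_le_sum fun i _ => ?_
    rw [(ω i).generatePair_cost_not_lex S M h]
    have h1 := (ω i).sampleBasis_cost_le (hS 1) (hS' 1)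
    have h2 := (ω i).backwardTransform_cost_le (hM (N + 1)) (hS' (N + 1)) (hM' (N + 1))
    have h3 := fglm_cost_le (ord := ord) (hc := (ω i).hCoeff) (gc := (ω i).gCoeff)
      (ω i).shape.deg_pos
    have h4 : (N + 1) * (ω i).shape.deg ^ 3 ≤ (N + 1) * d ^ 3 :=
      Nat.mul_le_mul_left _ (Nat.pow_le_pow_left (ω i).shape.deg_le 3)
    omega
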